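/- Let $M$ be a monoid. **Conventions.** A left $M$-set $X$ is free with basis $A\subseteq X$ if every $x\in X$ is uniquely of the form $x=ma$ with $m\in M$, $a\in A$. A left $M$-space is a topological space on which $M$ acts by continuous maps. A free left $M$-CW complex is a left $M$-space $Y=\varinjlim Y^{(n)}$ (colimit of $M$-spaces) with $Y^{(-1)}=\emptyset$ and with $Y^{(n)}$ obtained, for each $n\ge 0$, as a pushout of $M$-spaces $Y^{(n-1)}\leftarrow P_n\times S^{n-1}\to P_n\times B^n$, where $P_n$ is a free left $M$-set (discrete) and $M$ acts trivially on $B^n$ and $S^{n-1}$; $P_n$ is the $M$-set of $n$-cells. We write $X\simeq_M Y$ if there are $M$-equivariant continuous maps $f\colon X\to Y$ and $g\colon Y\to X$ with $gf$ and $fg$ homotopic to the identities through $M$-equivariant homotopies ($M$ acting trivially on $[0,1]$). **Collapsing schemes.** Let $K$ be a simplicial set with face maps $d_j$. Its $n$-cells are its non-degenerate $n$-simplices. A collapsing scheme $(E,R,C,c,i)$ on $K$ is a partition of the cells into essential, redundant and collapsible cells, $E_n\sqcup R_n\sqcup C_n$ in dimension $n$, with $C_0=\emptyset$, together with maps $c$,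 $i$ assigning to each $\tau\in R_n$ a cell $c(\tau)\in C_{n+1}$ and an index $i(\tau)\in\{0,\dots,n+1\}$ with $\tau=d_{i(\tau)}(c(\tau))$, such that $c\colon R_n\to C_{n+1}$ is bijective for all $n$, and such that there is no infinite descending chain $\tau_0\succ\tau_1\succ\cdots$ in any $R_n$, where $\tau'\prec\tau$ means that $\tau'=d_j(c(\tau))$ for some $j\ne i(\tau)$. The height of $\tau\in R_n$ is the maximal $k$ for which there is a chain $\tau=\tau_0\succ\tau_1\succ\dots\succ\tau_k$ in $R_n$. Let $M$ act on $K$ from the left. The scheme is $M$-equivariant, with basis cells $B=\bigsqcup_n B_n$, where $B_n$ is a set of $n$-cells, if: - (A1) $M$ acts by simplicial morphisms; - (A2) for every $m\in M$ and every simplex $\sigma$, $\sigma$ is a cell if and only if $m\sigma$ is, and $\sigma$ lies in $E$ (respectively $R$, $C$) if and only if $m\sigma$ does; - (A3) $c(m\sigma)=m\,c(\sigma)$ for all $m\in M$ and $\sigma\in R$; - (A4) for every $n$ the set of $n$-cells is a free left $M$-set with basis $B_n$; - (A5) for $\sigma\in R$, $\sigma\in B$ if and only if $c(\sigma)\in B$;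 - (A6) $\mathrm{height}(m\tau)=\mathrm{height}(\tau)$ for all $m\in M$ and $\tau\in R$. (Such a $K$ is in particular a rigid free left $M$-simplicial set: $M$ preserves non-degeneracy and the sets of cells are free $M$-sets.) Put $E_n^B=E_n\cap B_n$. **Theorem.** 1. Let $K$ be a rigid free left $M$-simplicial set with an $M$-equivariant collapsing scheme $(E,R,C,c,i)$ with basis cells $B$. Then there is a free left $M$-CW complex $Y$ with $Y\simeq_M|K|$, together with, for every $n$, an $M$-equivariant bijection between the set of $n$-cells of $Y$ and $E_n$; under this bijection the set of $n$-cells of $Y$ is a free left $M$-set with basis $E_n^B$. 2. Let $K$ be a simplicial set with commuting left and right actions of $M$ by simplicial morphisms, regarded as a left $M\times M^{op}$-simplicial set, and let $(E,R,C,c,i)$ be a collapsing scheme on $K$ with basis cells $B$ that is $M\times M^{op}$-equivariant. Then there is a free $M\times M^{op}$-CW complex $Y$ with $Y\simeq_{M\times M^{op}}|K|$, together with, for every $n$, an $M\times M^{op}$-equivariant bijection between the set of $n$-cells of $Y$ and $E_n$; under this bijection the set of $n$-cells of $Y$ is a free $M\times M^{op}$-set with basis $E_n^B$. -/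

import Mathlib

universe u

open CategoryTheory CategoryTheory.Limits Opposite
open scoped Simplicial TopCat

namespace MonoidCW

section Sets

/-- A subset `A` of a left `M`-set `X` is a free basis of `X` if every element of `X` can be
written uniquely as `m • a` with `m ∈ M` and `a ∈ A`. -/
def IsFreeBasis (M : Type u) [Monoid M] {X : Type u} [MulAction M X] (A : Set X) : Prop :=
  ∀ x : X, ∃! p : M × X, p.2 ∈ A ∧ p.1 • p.2 = x

end Sets

section Spaces

/-! A left `M`-space, for `M` a monoid with the discrete topology, is an object of
`Action TopCat M`: a space with a homomorphism from `M` to its monoid of continuous self-maps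
(multiplication in `End` is composition of maps, `f * g = f ∘ g`). -/

variable {M : Type u} [Monoid M]

/-- The action of `m ∈ M` on a point of a left `M`-space. -/
def actPt (X : Action TopCat.{u} M) (m : M) (x : X.V) : X.V :=
  (show X.V ⟶ X.V from X.ρ m) x

/-- Two `M`-equivariant maps are `M`-homotopic if there is an `M`-equivariant homotopy between
them, `M` acting trivially on the unit interval. -/
def MHomotopic {X Y : Action TopCat.{u} M} (f g : X ⟶ Y) : Prop :=
  ∃ H : ContinuousMap.Homotopy f.hom.hom g.hom.hom,
    ∀ (m : M) (t : unitInterval) (x : X.V), H (t, actPt X m x) = actPt Y m (H (t, x))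

/-- `M`-homotopy equivalence of left `M`-spaces. -/
def MHomotopyEquivalent (X Y : Action TopCat.{u} M) : Prop :=
  ∃ (f : X ⟶ Y) (g : Y ⟶ X), MHomotopic (f ≫ g) (𝟙 X) ∧ MHomotopic (g ≫ f) (𝟙 Y)

variable (M) in
/-- For an `M`-set `P` and a space `T`, the `M`-space `P × T`, with `P` discrete and `M` acting
trivially on `T`. (The disjoint union of copies of `T` indexed by `P` is `P × T`.) -/
def cellSpace (P : Type u) [MulAction M P] (T : TopCat.{u}) : Action TopCat.{u} M where
  V := TopCat.of (Σ _ : P, T)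
  ρ :=
    { toFun := fun m => TopCat.ofHom
        { toFun := fun x => ⟨m • x.1, x.2⟩
          continuous_toFun := continuous_sigma fun p =>
            continuous_sigmaMk (σ := fun _ : P => T) (i := m • p) }
      map_one' := TopCat.ext fun x => Sigma.ext (one_smul M x.1) HEq.rfl
      map_mul' := fun m n => TopCat.ext fun x => Sigma.ext (mul_smul m n x.1) HEq.rfl }

variable (M) in
/-- The `M`-map `P × S ⟶ P × T` induced by a continuous map `S ⟶ T`. -/
def cellSpaceMap (P : Type u) [MulAction M P] {S T : TopCat.{u}} (j : S ⟶ T) :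
    cellSpace M P S ⟶ cellSpace M P T where
  hom := TopCat.ofHom (X := Σ _ : P, S) (Y := Σ _ : P, T)
    { toFun := fun x => ⟨x.1, j x.2⟩
      continuous_toFun := continuous_sigma fun p =>
        (continuous_sigmaMk (σ := fun _ : P => T) (i := p)).comp j.hom.continuous }
  comm := fun _ => rfl

variable (M) in
/-- An `M`-CW complex structure on a left `M`-space `Y`. Here `cell n` is the `M`-set of `n`-cells,
`sk.obj n` is the `(n-1)`-skeleton `Y_{n-1}` (so `sk.obj 0 = Y_{-1}` is empty), the `n`-skeleton is
the pushout of `M`-spaces of `Y_{n-1} ← cell n × S^{n-1} → cell n × B^n`, and `Y` is the colimit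
of its skeleta. -/
structure MCWComplex (Y : Action TopCat.{u} M) where
  /-- the set of `n`-cells -/
  cell : ℕ → Type u
  /-- the action of `M` on the set of `n`-cells -/
  cellAction : ∀ n, MulAction M (cell n)
  /-- the sequence of skeleta, starting with the `(-1)`-skeleton -/
  sk : ℕ ⥤ Action TopCat.{u} M
  isEmpty_sk_zero : IsEmpty (sk.obj 0).V
  /-- the attaching maps of the `n`-cells -/
  attach : ∀ n, cellSpace M (cell n) (∂𝔻 n) ⟶ sk.obj n
  /-- the characteristic maps of the `n`-cells -/
  char : ∀ n, cellSpace M (cell n) (𝔻 n) ⟶ sk.obj (n + 1)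
  isPushout : ∀ n, IsPushout (attach n)
    (cellSpaceMap M (cell n) (TopCat.diskBoundaryInclusion n))
    (sk.map (homOfLE (Nat.le_succ n))) (char n)
  /-- the maps from the skeleta to `Y` -/
  incl : sk ⟶ (Functor.const ℕ).obj Y
  /-- `Y` is the colimit of its skeleta -/
  isColimit : IsColimit (Cocone.mk Y incl)

attribute [instance] MCWComplex.cellAction

/-- An `M`-CW complex is free if, for each `n`, its set of `n`-cells is a free `M`-set. -/
def MCWComplex.IsFree {Y : Action TopCat.{u} M} (W : MCWComplex M Y) : Prop :=
  ∀ n, ∃ A : Set (W.cell n), IsFreeBasis M A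

end Spaces

section Simplicial

/-- A collapsing scheme for a simplicial set `K`. The cells of `|K|` are identified with the
non-degenerate simplices of `K`. -/
structure CollapsingScheme (K : SSet.{u}) where
  /-- the essential `n`-cells -/
  E : ∀ n : ℕ, Set (K _⦋n⦌)
  /-- the redundant `n`-cells -/
  R : ∀ n : ℕ, Set (K _⦋n⦌)
  /-- the collapsible `n`-cells -/
  C : ∀ n : ℕ, Set (K _⦋n⦌)
  union_eq : ∀ n, E n ∪ R n ∪ C n = K.nonDegenerate n
  disjoint_ER : ∀ n, Disjoint (E n) (R n)
  disjoint_EC : ∀ n, Disjoint (E n) (C n)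
  disjoint_RC : ∀ n, Disjoint (R n) (C n)
  /-- collapsible cells have dimension at least one -/
  C_zero : C 0 = ∅
  /-- the collapsible cell matched with a redundant cell -/
  c : ∀ n, R n → C (n + 1)
  /-- the index of the face of `c τ` that is equal to `τ` -/
  i : ∀ n, R n → Fin (n + 2)
  face_eq : ∀ n (τ : R n), K.δ (i n τ) (c n τ : K _⦋n + 1⦌) = (τ : K _⦋n⦌)
  bijective_c : ∀ n, Function.Bijective (c n)
  /-- there is no infinite descending chain of redundant `n`-cells, where `τ'` is an immediate
  predecessor of `τ` if `τ' = d_j (c τ)` for some `j ≠ i τ` -/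
  no_infinite_chain : ∀ n, ¬ ∃ τ : ℕ → R n, ∀ k : ℕ,
    ∃ j : Fin (n + 2), j ≠ i n (τ k) ∧
      K.δ j (c n (τ k) : K _⦋n + 1⦌) = (τ (k + 1) : K _⦋n⦌)

namespace CollapsingScheme

variable {K : SSet.{u}} (S : CollapsingScheme K)

/-- `S.Pred τ' τ` : the redundant cell `τ'` is an immediate predecessor of `τ`. -/
def Pred {n : ℕ} (τ' τ : S.R n) : Prop :=
  ∃ j : Fin (n + 2), j ≠ S.i n τ ∧ K.δ j (S.c n τ : K _⦋n + 1⦌) = (τ' : K _⦋n⦌)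

/-- The height of a redundant cell `τ`: the maximal length `k` of a descending chain
`τ = τ₀ ≻ τ₁ ≻ ⋯ ≻ τₖ`. -/
noncomputable def height {n : ℕ} (τ : S.R n) : ℕ∞ :=
  ⨆ (p : RelSeries (Set.ofPred fun x : S.R n × S.R n => S.Pred x.2 x.1)) (_ : p.head = τ), (p.length : ℕ∞)

end CollapsingScheme

variable {M : Type u} [Monoid M]

/-- The action of `m ∈ M` on an `n`-simplex of a left `M`-simplicial set. A left `M`-simplicial
set, that is, a simplicial set on which `M` acts from the left by simplicial morphisms, is an
object of `Action SSet M`. -/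
def actSimplex (K : Action SSet.{u} M) {n : ℕ} (m : M) (x : K.V _⦋n⦌) : K.V _⦋n⦌ :=
  (show K.V ⟶ K.V from K.ρ m).app (op ⦋n⦌) x

/-- The collapsing scheme `S` on the left `M`-simplicial set `K` is `M`-equivariant, where `B n` is
the chosen set of basis `n`-cells. -/
structure IsEquivariantScheme (K : Action SSet.{u} M) (S : CollapsingScheme K.V)
    (B : ∀ n : ℕ, Set (K.V _⦋n⦌)) : Prop where
  /-- `M` preserves and reflects being a cell (so `K` is rigid) and the type of a cell -/
  cell_iff : ∀ (n : ℕ) (m : M) (x : K.V _⦋n⦌),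
    actSimplex K m x ∈ K.V.nonDegenerate n ↔ x ∈ K.V.nonDegenerate n
  E_iff : ∀ (n : ℕ) (m : M) (x : K.V _⦋n⦌), actSimplex K m x ∈ S.E n ↔ x ∈ S.E n
  R_iff : ∀ (n : ℕ) (m : M) (x : K.V _⦋n⦌), actSimplex K m x ∈ S.R n ↔ x ∈ S.R n
  C_iff : ∀ (n : ℕ) (m : M) (x : K.V _⦋n⦌), actSimplex K m x ∈ S.C n ↔ x ∈ S.C n
  /-- the matching commutes with the action -/
  c_act : ∀ (n : ℕ) (m : M) (σ : S.R n),
    (S.c n ⟨actSimplex K m (σ : K.V _⦋n⦌), (R_iff n m σ).2 σ.2⟩ : K.V _⦋n + 1⦌) = actSimplex K m (S.c n σ)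
  /-- the set of `n`-cells is a free `M`-set with basis `B n` -/
  B_subset : ∀ n : ℕ, B n ⊆ K.V.nonDegenerate n
  B_basis : ∀ (n : ℕ), ∀ x ∈ K.V.nonDegenerate n,
    ∃! p : M × K.V _⦋n⦌, p.2 ∈ B n ∧ actSimplex K p.1 p.2 = x
  /-- the matching respects the basis -/
  B_iff : ∀ (n : ℕ) (σ : S.R n), (σ : K.V _⦋n⦌) ∈ B n ↔ (S.c n σ : K.V _⦋n + 1⦌) ∈ B (n + 1)
  height_act : ∀ (n : ℕ) (m : M) (τ : S.R n),
    S.height ⟨actSimplex K m (τ : K.V _⦋n⦌), (R_iff n m τ).2 τ.2⟩ = S.height τ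

/-- The geometric realisation of a left `M`-simplicial set, with the induced action of `M`. -/
noncomputable def realization (K : Action SSet.{u} M) : Action TopCat.{u} M :=
  (SSet.toTop.{u}.mapAction M).obj K

/-- A simplicial set with commuting left and right actions of `M` by simplicial morphisms, viewed
as a left `M × Mᵐᵒᵖ`-simplicial set. -/
def biAction (K : SSet.{u}) (l : M →* End K) (r : Mᵐᵒᵖ →* End K)
    (h : ∀ (m : M) (n : Mᵐᵒᵖ), Commute (l m) (r n)) : Action SSet.{u} (M × Mᵐᵒᵖ) where
  V := K
  ρ := MonoidHom.noncommCoprod l r h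

end Simplicial

end MonoidCW

/-!
# Collapsing an equivariant simplicial set onto its essential cells

The two-sided version is the left version for the monoid `M × Mᵐᵒᵖ`, so let `M` act on `K` from the
left.

**The filtration.** Let `lower n` be the subcomplex of `K` generated by the simplices of dimension
less than `n` and the collapsible `n`-cells, and let `upper n` be generated by `lower n` and the
essential `n`-cells. Passing from `lower n` to `upper n` attaches the essential `n`-cells along
their boundaries. Passing from `upper n` to `lower (n + 1)` adds each redundant `n`-cell `τ`
together with the collapsible cell `c τ`, that is, it attaches the simplex `c τ` along the horn
opposite to its face `τ`. If the cells are added in the order of their rank (first by the length of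
the longest descending chain, then by the index of the face), the other faces of `c τ` are already
present (`IsEquivariantScheme.exists_isPushout_stage`). All of this is equivariant: the matching
commutes with the action by assumption, and `i (m τ) = i τ`, as `m τ ≺ m τ` otherwise.

**The complex.** Put `Y₀ = |lower 0| = ∅`, and let `Yₙ₊₁` be the pushout of
`|upper n| ← |lower n| → Yₙ`; the map `|lower (n + 1)| → Yₙ₊₁` is any extension of the map from
`|upper n|`. By construction, `Yₙ₊₁` arises from `Yₙ` by attaching the essential `n`-cells. There
results a map `q : |K| → Y` on the colimits (`toCollapse`).

**The equivalence.** No deformation is written down; everything is done by lifting properties. Call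
a map of `M`-spaces a fibration if its underlying map is a Hurewicz fibration. For a fibration
`p : Z → B`, let `P` be the space of paths in the fibres of `p`.

* The endpoint map `P → Z ×_B Z` is a fibration (`isMFibration_endpoints`), and `P → Z`, evaluation
  at the end, has the right lifting property against `∂𝔻 n → 𝔻 n` (`hasLiftingProperty_pathEnd`).
* Fibrations have the right lifting property against the realization of a horn inclusion
  (`HurewiczFibration.hasLiftingProperty_horn`).
* As the cells form free `M`-sets, these statements pass to `M`-spaces
  (`hasLiftingProperty_cellSpaceMap`), hence to `|lower n| → |upper n| → |lower (n + 1)|`.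

It follows by induction on `n` that every commutative square from `q` to `p` has a lift `Y → Z` for
which the lower triangle commutes and the upper one commutes up to a homotopy along the fibres
(`exists_lift_up_to_homotopy`). For `p : |K| → pt`, this gives a map `g : Y → |K|` and a homotopy
from `g ∘ q` to the identity. For the endpoint map of the path space of `Y`, it gives a homotopy
from `q ∘ g` to the identity (`mHomotopyEquivalent_of_lifts`).
-/

namespace MonoidCW

/-! ### Fibrations and lifting along deformations -/

section Fibrations

open unitInterval

/-- Two continuous maps defined on closed subsets covering a space and agreeing on the overlap glue
to a continuous map. -/
lemma exists_glue {T E : Type*} [TopologicalSpace T] [TopologicalSpace E] {A B : Set T}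
    (hA : IsClosed A) (hB : IsClosed B) (hAB : ∀ x, x ∈ A ∨ x ∈ B) (f : C(A, E)) (g : C(B, E))
    (h : ∀ x (ha : x ∈ A) (hb : x ∈ B), f ⟨x, ha⟩ = g ⟨x, hb⟩) :
    ∃ F : C(T, E), (∀ x (ha : x ∈ A), F x = f ⟨x, ha⟩) ∧ ∀ x (hb : x ∈ B), F x = g ⟨x, hb⟩ := by
  classical
  let F : T → E := fun x => if ha : x ∈ A then f ⟨x, ha⟩ else g ⟨x, (hAB x).resolve_left ha⟩
  have hFA : ∀ x (ha : x ∈ A), F x = f ⟨x, ha⟩ := fun x ha => dif_pos ha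
  have hFB : ∀ x (hb : x ∈ B), F x = g ⟨x, hb⟩ := fun x hb => by
    by_cases ha : x ∈ A
    · rw [hFA x ha, h x ha hb]
    · exact dif_neg ha
  refine ⟨⟨F, ?_⟩, hFA, hFB⟩
  have hA' : ContinuousOn F A := by
    rw [continuousOn_iff_continuous_domRestrict]
    exact f.continuous.congr fun x => (hFA x.1 x.2).symm
  have hB' : ContinuousOn F B := by
    rw [continuousOn_iff_continuous_domRestrict]
    exact g.continuous.congr fun x => (hFB x.1 x.2).symm
  have := hA'.union_of_isClosed hB' hA hB
  rwa [show A ∪ B = Set.univ from Set.eq_univ_of_forall hAB, continuousOn_univ] at this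

variable {E B : Type u} [TopologicalSpace E] [TopologicalSpace B]

/-- A Hurewicz fibration: a map with the homotopy lifting property for all spaces (of the same
universe). -/
def HurewiczFibration (p : C(E, B)) : Prop :=
  ∀ (X : Type u) [TopologicalSpace X] (f : C(X, E)) (g : C(X × I, B)), (∀ x, g (x, 0) = p (f x)) →
    ∃ G : C(X × I, E), (∀ x, G (x, 0) = f x) ∧ ∀ y, p (G y) = g y

lemma hurewiczFibration_of_subsingleton [Subsingleton B] (p : C(E, B)) : HurewiczFibration p :=
  fun _ _ f _ _ => ⟨f.comp ContinuousMap.fst, fun _ => rfl, fun _ => Subsingleton.elim _ _⟩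

/-- The homotopy lifting property along a flow `φ` which reaches the point `y` at time `u y`,
starting at time `0` from a point over which a lift `m` is already given. Where `u` vanishes, the
resulting lift agrees with `m`. -/
lemma HurewiczFibration.exists_lift_of_flow {p : C(E, B)} (hp : HurewiczFibration p)
    {T : Type*} [TopologicalSpace T] {T' : Type u} [TopologicalSpace T'] (e : T' ≃ₜ T)
    (b : C(T, B)) (m : C(T, E)) (φ : C(T × I, T)) (u : C(T, I))
    (hm : ∀ y, p (m y) = b (φ (y, 0))) (hφ : ∀ y, φ (y, u y) = y) :
    ∃ G : C(T, E), (∀ y, p (G y) = b y) ∧ ∀ y, u y = 0 → G y = m y := by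
  obtain ⟨G, hG₀, hG⟩ := hp T' (m.comp e)
    (b.comp (φ.comp ⟨fun y : T' × I => (e y.1, y.2), by fun_prop⟩)) (fun x => by simp [hm])
  refine ⟨G.comp ⟨fun y => (e.symm y, u y), by fun_prop⟩, fun y => ?_, fun y hy => ?_⟩
  · simp [hG, hφ]
  · simp [hy, hG₀]

section Cylinder

variable {V : Type} [NormedAddCommGroup V]

/-- The closed unit ball. -/
abbrev UBall (V : Type) [NormedAddCommGroup V] : Type := Metric.closedBall (0 : V) 1

/-- The unit sphere. -/
abbrev USphere (V : Type) [NormedAddCommGroup V] : Type := Metric.sphere (0 : V) 1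

/-- The inclusion of the unit sphere into the closed unit ball. -/
def sphereToBall (v : USphere V) : UBall V := ⟨v.1, Metric.sphere_subset_closedBall v.2⟩

/-- The height of the point at which the line from `(0, 2)` to `(v, t)` in `V × [0, 1]` leaves
the cylinder over the unit ball. -/
noncomputable def exitHeight (v : UBall V) (t : I) : ℝ :=
  2 - (2 - (t : ℝ)) / max ‖(v : V)‖ ((2 - (t : ℝ)) / 2)

lemma norm_le_one (v : UBall V) : ‖(v : V)‖ ≤ 1 := mem_closedBall_zero_iff.1 v.2

lemma continuous_exitHeight : Continuous fun y : UBall V × I => exitHeight y.1 y.2 := by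
  unfold exitHeight
  refine continuous_const.sub (Continuous.div (by fun_prop) (by fun_prop) fun y => ?_)
  have := y.2.2.2
  exact ne_of_gt (lt_of_lt_of_le (by linarith) (le_max_right _ _))

lemma exitHeight_nonneg (v : UBall V) (t : I) : 0 ≤ exitHeight v t := by
  have := t.2.2
  have h2 : (2 - (t : ℝ)) / 2 ≤ max ‖(v : V)‖ ((2 - (t : ℝ)) / 2) := le_max_right _ _
  have h3 : 0 < max ‖(v : V)‖ ((2 - (t : ℝ)) / 2) := lt_of_lt_of_le (by linarith) h2
  rw [exitHeight, sub_nonneg, div_le_iff₀ h3]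
  linarith

lemma exitHeight_le (v : UBall V) (t : I) : exitHeight v t ≤ t := by
  have := t.2.2
  have h2 : (2 - (t : ℝ)) / 2 ≤ max ‖(v : V)‖ ((2 - (t : ℝ)) / 2) := le_max_right _ _
  have h3 : 0 < max ‖(v : V)‖ ((2 - (t : ℝ)) / 2) := lt_of_lt_of_le (by linarith) h2
  have h4 : max ‖(v : V)‖ ((2 - (t : ℝ)) / 2) ≤ 1 :=
    max_le (norm_le_one v) (by linarith [t.2.1])
  have : (2 - (t : ℝ)) ≤ (2 - (t : ℝ)) / max ‖(v : V)‖ ((2 - (t : ℝ)) / 2) := by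
    rw [le_div_iff₀ h3]; nlinarith
  unfold exitHeight; linarith

lemma exitHeight_of_le (v : UBall V) (t : I) (h : 2 * ‖(v : V)‖ ≤ 2 - (t : ℝ)) :
    exitHeight v t = 0 := by
  have := t.2.2
  rw [exitHeight, max_eq_right (by linarith), div_div_eq_mul_div, mul_div_assoc]
  rw [mul_comm, div_mul_cancel₀ _ (by linarith)]; ring

lemma exitHeight_of_ge (v : UBall V) (t : I) (h : 2 - (t : ℝ) ≤ 2 * ‖(v : V)‖) :
    exitHeight v t = 2 - (2 - (t : ℝ)) / ‖(v : V)‖ := by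
  rw [exitHeight, max_eq_left (by linarith)]

variable [NormedSpace ℝ V]

/-- Lifting over a cylinder on the unit ball against a Hurewicz fibration, relative to the bottom
and the sides. The cylinder is swept out along the lines through `(0, 2)`. -/
lemma HurewiczFibration.exists_cylinder_lift {p : C(E, B)} (hp : HurewiczFibration p)
    {X : Type u} [TopologicalSpace X]
    (f : C(X × UBall V, E)) (g : C(X × USphere V × I, E)) (b : C(X × UBall V × I, B))
    (hfg : ∀ x v, g (x, v, 0) = f (x, sphereToBall v))
    (hf : ∀ x v, p (f (x, v)) = b (x, v, 0))
    (hg : ∀ x v t, p (g (x, v, t)) = b (x, sphereToBall v, t)) :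
    ∃ L : C(X × UBall V × I, E), (∀ y, p (L y) = b y) ∧ (∀ x v, L (x, v, 0) = f (x, v)) ∧
      ∀ x v t, L (x, sphereToBall v, t) = g (x, v, t) := by
  have ht : ∀ t : I, 0 < 2 - (t : ℝ) := fun t => by linarith [t.2.2]
  let A₁ : Set (X × UBall V × I) := {y | 2 * ‖(y.2.1 : V)‖ ≤ 2 - (y.2.2 : ℝ)}
  let A₂ : Set (X × UBall V × I) := {y | 2 - (y.2.2 : ℝ) ≤ 2 * ‖(y.2.1 : V)‖}
  have hA₁ : IsClosed A₁ := isClosed_le (by fun_prop) (by fun_prop)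
  have hA₂ : IsClosed A₂ := isClosed_le (by fun_prop) (by fun_prop)
  have hpos : ∀ y : A₂, 0 < ‖(y.1.2.1 : V)‖ := fun y => by
    have h1 : 2 - (y.1.2.2 : ℝ) ≤ 2 * ‖(y.1.2.1 : V)‖ := y.2
    have h2 := ht y.1.2.2
    linarith
  let r₁ : C(A₁, X × UBall V) :=
    ⟨fun y => (y.1.1, ⟨(2 / (2 - (y.1.2.2 : ℝ))) • (y.1.2.1 : V), by
      have h1 : 2 * ‖(y.1.2.1 : V)‖ ≤ 2 - (y.1.2.2 : ℝ) := y.2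
      have h2 := ht y.1.2.2
      rw [mem_closedBall_zero_iff, norm_smul, Real.norm_of_nonneg (by positivity),
        div_mul_eq_mul_div, div_le_one h2]
      exact h1⟩), by
      refine Continuous.prodMk (by fun_prop) (Continuous.subtype_mk ?_ _)
      refine Continuous.smul (Continuous.div (by fun_prop) (by fun_prop) fun y => ?_) (by fun_prop)
      exact (ht _).ne'⟩
  let r₂ : C(A₂, X × USphere V × I) :=
    ⟨fun y => (y.1.1, ⟨(‖(y.1.2.1 : V)‖)⁻¹ • (y.1.2.1 : V), by
        rw [mem_sphere_zero_iff_norm, norm_smul, norm_inv, norm_norm,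
          inv_mul_cancel₀ (hpos y).ne']⟩,
      ⟨exitHeight y.1.2.1 y.1.2.2, exitHeight_nonneg _ _,
        (exitHeight_le _ _).trans y.1.2.2.2.2⟩), by
      refine Continuous.prodMk (by fun_prop) (Continuous.prodMk (Continuous.subtype_mk ?_ _)
        (Continuous.subtype_mk ?_ _))
      · exact Continuous.smul (Continuous.inv₀ (by fun_prop) fun y => (hpos y).ne') (by fun_prop)
      · exact continuous_exitHeight.comp (continuous_snd.comp continuous_subtype_val)⟩
  obtain ⟨m, hm₁, hm₂⟩ := exists_glue hA₁ hA₂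
    (fun y => le_total (2 * ‖(y.2.1 : V)‖) (2 - (y.2.2 : ℝ))) (f.comp r₁) (g.comp r₂)
    (fun y h1 h2 => by
      have h1' : 2 * ‖(y.2.1 : V)‖ ≤ 2 - (y.2.2 : ℝ) := h1
      have h2' : 2 - (y.2.2 : ℝ) ≤ 2 * ‖(y.2.1 : V)‖ := h2
      have h := le_antisymm h1' h2'
      have hp' := hpos ⟨y, h2⟩
      have e1 : (r₂ ⟨y, h2⟩).2.2 = 0 := Subtype.ext (exitHeight_of_le _ _ h1')
      have e2 : r₂ ⟨y, h2⟩ = (y.1, (r₂ ⟨y, h2⟩).2.1, 0) := by rw [← e1]; rfl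
      change f _ = g _
      rw [e2, hfg]
      congr 1
      refine Prod.ext rfl (Subtype.ext ?_)
      change (2 / (2 - (y.2.2 : ℝ))) • (y.2.1 : V) = (‖(y.2.1 : V)‖)⁻¹ • (y.2.1 : V)
      rw [← h, div_mul_cancel_left₀ two_ne_zero])
  -- the point at height `min (exitHeight + τ) t` on the line from `(0, 2)` to `(v, t)`
  let ht' : X × UBall V × I → I → ℝ := fun y τ => min (exitHeight y.2.1 y.2.2 + τ) y.2.2
  have hh0 : ∀ y τ, 0 ≤ ht' y τ := fun y τ =>
    le_min (add_nonneg (exitHeight_nonneg _ _) τ.2.1) y.2.2.2.1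
  have hh1 : ∀ y τ, ht' y τ ≤ 1 := fun y τ => (min_le_right _ _).trans y.2.2.2.2
  have hhe : ∀ y τ, exitHeight y.2.1 y.2.2 ≤ ht' y τ := fun y τ =>
    le_min (by linarith [τ.2.1]) (exitHeight_le _ _)
  have hcont : Continuous fun z : (X × UBall V × I) × I => ht' z.1 z.2 := by
    have := (continuous_exitHeight (V := V)).comp
      (continuous_snd.comp (continuous_fst : Continuous (Prod.fst : (X × UBall V × I) × I → _)))
    exact (this.add (by fun_prop)).min (by fun_prop)
  let φ : C((X × UBall V × I) × I, X × UBall V × I) :=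
    ⟨fun z => (z.1.1, ⟨((2 - ht' z.1 z.2) / (2 - (z.1.2.2 : ℝ))) • (z.1.2.1 : V), by
        have h2 := ht z.1.2.2
        have h3 := hh1 z.1 z.2
        rw [mem_closedBall_zero_iff, norm_smul,
          Real.norm_of_nonneg (div_nonneg (by linarith) h2.le), div_mul_eq_mul_div, div_le_one h2]
        have h4 := hhe z.1 z.2
        have h5 : 0 < max ‖(z.1.2.1 : V)‖ ((2 - (z.1.2.2 : ℝ)) / 2) :=
          lt_of_lt_of_le (by linarith) (le_max_right _ _)
        have h6 : 2 - ht' z.1 z.2 ≤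
            (2 - (z.1.2.2 : ℝ)) / max ‖(z.1.2.1 : V)‖ ((2 - (z.1.2.2 : ℝ)) / 2) := by
          unfold exitHeight at h4; linarith
        rw [le_div_iff₀ h5] at h6
        refine le_trans (mul_le_mul_of_nonneg_left (le_max_left _ _) (by linarith)) h6⟩,
      ⟨ht' z.1 z.2, hh0 _ _, hh1 _ _⟩), by
      refine Continuous.prodMk (by fun_prop) (Continuous.prodMk (Continuous.subtype_mk ?_ _)
        (Continuous.subtype_mk hcont _))
      exact Continuous.smul (Continuous.div (continuous_const.sub hcont) (by fun_prop)
        fun y => (ht _).ne') (by fun_prop)⟩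
  let w : C(X × UBall V × I, I) := ⟨fun y => ⟨(y.2.2 : ℝ) - exitHeight y.2.1 y.2.2,
    sub_nonneg.2 (exitHeight_le _ _), by
      linarith [exitHeight_nonneg y.2.1 y.2.2, y.2.2.2.2]⟩, by
    refine Continuous.subtype_mk (Continuous.sub (by fun_prop) ?_) _
    exact continuous_exitHeight.comp continuous_snd⟩
  obtain ⟨L, hL, hLm⟩ := hp.exists_lift_of_flow (Homeomorph.refl _) b m φ w (fun y => by
    have hexit : ht' y 0 = exitHeight y.2.1 y.2.2 := by
      simp only [ht', Set.Icc.coe_zero, add_zero]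
      exact min_eq_left (exitHeight_le _ _)
    rcases le_total (2 * ‖(y.2.1 : V)‖) (2 - (y.2.2 : ℝ)) with h | h
    · rw [hm₁ y h]
      change p (f (y.1, _)) = _
      rw [hf]
      have h0 := exitHeight_of_le _ _ h
      congr 1
      refine Prod.ext rfl (Prod.ext (Subtype.ext ?_) (Subtype.ext ?_))
      · change (2 / (2 - (y.2.2 : ℝ))) • (y.2.1 : V) =
          ((2 - ht' y 0) / (2 - (y.2.2 : ℝ))) • (y.2.1 : V)
        rw [hexit, h0, sub_zero]
      · change (0 : ℝ) = ht' y 0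
        rw [hexit, h0]
    · rw [hm₂ y h]
      have h0 := exitHeight_of_ge _ _ h
      change p (g (y.1, _, _)) = _
      rw [hg]
      congr 1
      refine Prod.ext rfl (Prod.ext (Subtype.ext ?_) (Subtype.ext ?_))
      · change (‖(y.2.1 : V)‖)⁻¹ • (y.2.1 : V) =
          ((2 - ht' y 0) / (2 - (y.2.2 : ℝ))) • (y.2.1 : V)
        rw [hexit, h0]
        congr 1
        have := (ht y.2.2).ne'
        have := (hpos ⟨y, h⟩).ne'
        field_simp
        ring
      · change exitHeight y.2.1 y.2.2 = ht' y 0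
        rw [hexit]) (fun y => by
    have hexit : ht' y (w y) = y.2.2 := by
      change min (exitHeight y.2.1 y.2.2 + ((y.2.2 : ℝ) - exitHeight y.2.1 y.2.2)) y.2.2 = _
      simp
    refine Prod.ext rfl (Prod.ext (Subtype.ext ?_) (Subtype.ext hexit))
    change ((2 - ht' y (w y)) / (2 - (y.2.2 : ℝ))) • (y.2.1 : V) = y.2.1
    rw [hexit, div_self (ht _).ne', one_smul])
  refine ⟨L, hL, fun x v => ?_, fun x v t => ?_⟩
  · have h : 2 * ‖(v : V)‖ ≤ 2 - ((0 : I) : ℝ) := by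
      simpa using norm_le_one v
    rw [hLm, hm₁ _ h]
    · change f (x, _) = _
      congr 1
      refine Prod.ext rfl (Subtype.ext ?_)
      change (2 / (2 - ((0 : I) : ℝ))) • (v : V) = v
      simp
    · exact Subtype.ext (by simp [w, exitHeight_of_le v 0 h])
  · have hv : ‖((sphereToBall v : UBall V) : V)‖ = 1 := mem_sphere_zero_iff_norm.1 v.2
    have h : 2 - (t : ℝ) ≤ 2 * ‖((sphereToBall v : UBall V) : V)‖ := by
      rw [hv]; linarith [t.2.1]
    have he : exitHeight (sphereToBall v) t = t := by
      rw [exitHeight_of_ge _ _ h, hv]; ring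
    rw [hLm, hm₂ _ h]
    · change g (x, _, _) = _
      congr 1
      refine Prod.ext rfl (Prod.ext (Subtype.ext ?_) (Subtype.ext he))
      change (‖((sphereToBall v : UBall V) : V)‖)⁻¹ • ((sphereToBall v : UBall V) : V) = v
      rw [hv, inv_one, one_smul]; rfl
    · exact Subtype.ext (by simp [w, he])

end Cylinder

end Fibrations

/-! ### Path objects of maps of `M`-spaces -/

section PathObjects

open unitInterval

variable {M : Type u} [Monoid M]

lemma actPt_one (X : Action TopCat.{u} M) (x : X.V) : actPt X 1 x = x := by
  simp only [actPt, map_one]; rfl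

lemma actPt_mul (X : Action TopCat.{u} M) (m n : M) (x : X.V) :
    actPt X (m * n) x = actPt X m (actPt X n x) := by
  simp only [actPt, map_mul]; rfl

lemma continuous_actPt (X : Action TopCat.{u} M) (m : M) : Continuous (actPt X m) :=
  (show X.V ⟶ X.V from X.ρ m).hom.continuous

lemma hom_actPt {X Y : Action TopCat.{u} M} (f : X ⟶ Y) (m : M) (x : X.V) :
    f.hom (actPt X m x) = actPt Y m (f.hom x) :=
  ConcreteCategory.congr_hom (f.comm m) x

/-- The `M`-space given by a space and a family of continuous self-maps satisfying the laws of an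
action. -/
def mkMSpace (X : Type u) [TopologicalSpace X] (a : M → C(X, X)) (h1 : ∀ x, a 1 x = x)
    (hmul : ∀ m n x, a (m * n) x = a m (a n x)) : Action TopCat.{u} M where
  V := TopCat.of X
  ρ :=
    { toFun := fun m => TopCat.ofHom (a m)
      map_one' := TopCat.ext h1
      map_mul' := fun m n => TopCat.ext (hmul m n) }

/-- The map of `M`-spaces given by an equivariant continuous map. -/
def mkMHom {X Y : Action TopCat.{u} M} (f : C(X.V, Y.V))
    (h : ∀ m x, f (actPt X m x) = actPt Y m (f x)) : X ⟶ Y where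
  hom := TopCat.ofHom f
  comm := fun m => TopCat.ext (h m)

lemma mhom_ext {X Y : Action TopCat.{u} M} {f g : X ⟶ Y} (h : ∀ x, f.hom x = g.hom x) : f = g :=
  Action.Hom.ext (TopCat.ext h)

variable {Z B : Action TopCat.{u} M} (p : Z ⟶ B)

/-- The underlying space of the path object of `p`: paths in `Z` whose image in `B` is constant. -/
abbrev PathSet : Type u := {γ : C(I, Z.V) // ∀ s, p.hom (γ s) = p.hom (γ 0)}

/-- The path object of `p : Z ⟶ B`: the `M`-space of paths in `Z` whose image in `B` is
constant. -/
def pathObj : Action TopCat.{u} M :=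
  mkMSpace (PathSet p)
    (fun m => ⟨fun γ => ⟨(ContinuousMap.mk _ (continuous_actPt Z m)).comp γ.1, fun s => by
        change p.hom (actPt Z m _) = p.hom (actPt Z m _)
        rw [hom_actPt, hom_actPt, γ.2]⟩,
      ((ContinuousMap.continuous_postcomp _).comp continuous_subtype_val).subtype_mk _⟩)
    (fun γ => Subtype.ext (ContinuousMap.ext fun s => actPt_one Z (γ.1 s)))
    (fun m n γ => Subtype.ext (ContinuousMap.ext fun s => actPt_mul Z m n (γ.1 s)))

/-- The underlying space of the kernel pair of `p`. -/
abbrev KerSet : Type u := {z : Z.V × Z.V // p.hom z.1 = p.hom z.2}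

/-- The action of `m ∈ M` on the kernel pair of `p`. -/
def kerAct (m : M) : C(KerSet p, KerSet p) where
  toFun z := ⟨(actPt Z m z.1.1, actPt Z m z.1.2), (hom_actPt p m z.1.1).trans
    ((congrArg (actPt B m) z.2).trans (hom_actPt p m z.1.2).symm)⟩
  continuous_toFun :=
    (((continuous_actPt Z m).comp (continuous_fst.comp continuous_subtype_val)).prodMk
      ((continuous_actPt Z m).comp (continuous_snd.comp continuous_subtype_val))).subtype_mk _

/-- The kernel pair `Z ×_B Z` of `p : Z ⟶ B`. -/
def kerPair : Action TopCat.{u} M :=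
  mkMSpace (KerSet p) (kerAct p)
    (fun z => Subtype.ext (Prod.ext (actPt_one Z z.1.1) (actPt_one Z z.1.2)))
    (fun m n z => Subtype.ext (Prod.ext (actPt_mul Z m n z.1.1) (actPt_mul Z m n z.1.2)))

/-- The endpoint map of the path object. -/
def endpoints : pathObj p ⟶ kerPair p :=
  mkMHom (X := pathObj p) (Y := kerPair p)
    ⟨fun γ : PathSet p => (⟨(γ.1 0, γ.1 1), (γ.2 1).symm⟩ : KerSet p), by
      refine Continuous.subtype_mk (Continuous.prodMk ?_ ?_) _ <;>
      exact (ContinuousEvalConst.continuous_eval_const _).comp continuous_subtype_val⟩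
    (fun _ _ => rfl)

/-- The first projection of the kernel pair. -/
def kerFst : kerPair p ⟶ Z :=
  mkMHom (X := kerPair p) ⟨fun z : KerSet p => z.1.1, by fun_prop⟩ (fun _ _ => rfl)

/-- The second projection of the kernel pair. -/
def kerSnd : kerPair p ⟶ Z :=
  mkMHom (X := kerPair p) ⟨fun z : KerSet p => z.1.2, by fun_prop⟩ (fun _ _ => rfl)

/-- The starting point of a path. -/
def pathStart : pathObj p ⟶ Z := endpoints p ≫ kerFst p

/-- The end point of a path. -/
def pathEnd : pathObj p ⟶ Z := endpoints p ≫ kerSnd p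

lemma pathStart_comp : pathStart p ≫ p = pathEnd p ≫ p :=
  mhom_ext fun γ : PathSet p => (γ.2 1).symm

variable {p} in
/-- The map to the kernel pair with given components. -/
def kerLift {X : Action TopCat.{u} M} (f g : X ⟶ Z) (h : f ≫ p = g ≫ p) : X ⟶ kerPair p :=
  mkMHom (Y := kerPair p)
    ⟨fun x => (⟨(f.hom x, g.hom x), ConcreteCategory.congr_hom (congrArg Action.Hom.hom h) x⟩ :
        KerSet p),
      (Continuous.prodMk f.hom.hom.continuous g.hom.hom.continuous).subtype_mk _⟩
    (fun m x => Subtype.ext (Prod.ext (hom_actPt f m x) (hom_actPt g m x)))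

lemma kerLift_fst {X : Action TopCat.{u} M} (f g : X ⟶ Z) (h : f ≫ p = g ≫ p) :
    kerLift f g h ≫ kerFst p = f := rfl

lemma kerLift_snd {X : Action TopCat.{u} M} (f g : X ⟶ Z) (h : f ≫ p = g ≫ p) :
    kerLift f g h ≫ kerSnd p = g := rfl

lemma kerPair_ext {X : Action TopCat.{u} M} {f g : X ⟶ kerPair p}
    (h₁ : f ≫ kerFst p = g ≫ kerFst p) (h₂ : f ≫ kerSnd p = g ≫ kerSnd p) : f = g :=
  mhom_ext fun x => Subtype.ext (Prod.ext
    (ConcreteCategory.congr_hom (congrArg Action.Hom.hom h₁) x)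
    (ConcreteCategory.congr_hom (congrArg Action.Hom.hom h₂) x))

/-- The underlying continuous map of a map of `M`-spaces is a Hurewicz fibration. -/
abbrev IsMFibration : Prop := HurewiczFibration p.hom.hom

variable {p}

/-- The endpoint map of the path object of a Hurewicz fibration is a Hurewicz fibration: this is
a lifting problem for the square, relative to three of its sides. -/
lemma isMFibration_endpoints (hp : IsMFibration p) : IsMFibration (endpoints p) := by
  intro X _ f g hfg
  -- `f` and `g` with their actual types, and the parametrization of `[0, 1]` by `[-1, 1]`
  let f' : C(X, PathSet p) := f
  let g' : C(X × I, KerSet p) := g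
  have hfg' : ∀ x, g' (x, 0) = ⟨((f' x).1 0, (f' x).1 1), ((f' x).2 1).symm⟩ := hfg
  let c : C(UBall ℝ, I) := ⟨fun v => ⟨((v : ℝ) + 1) / 2, by
      have := norm_le_one v; rw [Real.norm_eq_abs, abs_le] at this; linarith, by
      have := norm_le_one v; rw [Real.norm_eq_abs, abs_le] at this; linarith⟩, by fun_prop⟩
  let d : C(I, UBall ℝ) := ⟨fun s => ⟨2 * (s : ℝ) - 1, by
      rw [mem_closedBall_zero_iff, Real.norm_eq_abs, abs_le]
      constructor <;> linarith [s.2.1, s.2.2]⟩, by fun_prop⟩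
  have hcd : ∀ s, c (d s) = s := fun s => Subtype.ext (by simp [c, d])
  let side : X × USphere ℝ × I → Z.V := fun y =>
    if (y.2.1 : ℝ) ≤ 0 then (g' (y.1, y.2.2)).1.1 else (g' (y.1, y.2.2)).1.2
  have hside : Continuous side := by
    refine Continuous.if_le ?_ ?_ (by fun_prop) continuous_const fun y hy => ?_
    · exact continuous_fst.comp (continuous_subtype_val.comp (g'.continuous.comp (by fun_prop)))
    · exact continuous_snd.comp (continuous_subtype_val.comp (g'.continuous.comp (by fun_prop)))
    · exact absurd hy (Metric.ne_of_mem_sphere y.2.1.2 one_ne_zero)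
  have hsph : ∀ v : USphere ℝ, ((v : ℝ) ≤ 0 ∧ c (sphereToBall v) = 0) ∨
      (¬ (v : ℝ) ≤ 0 ∧ c (sphereToBall v) = 1) := fun v => by
    have h : |(v : ℝ)| = 1 := by rw [← Real.norm_eq_abs]; exact mem_sphere_zero_iff_norm.1 v.2
    rcases eq_or_eq_neg_of_abs_eq h with h | h
    · exact Or.inr ⟨by rw [h]; norm_num, Subtype.ext (by simp [c, sphereToBall, h])⟩
    · exact Or.inl ⟨by rw [h]; norm_num, Subtype.ext (by simp [c, sphereToBall, h])⟩
  obtain ⟨L, hL, hL₀, hLs⟩ := hp.exists_cylinder_lift (V := ℝ) (X := X)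
    ⟨fun y => (f' y.1).1 (c y.2), by
      exact continuous_eval.comp ((continuous_subtype_val.comp (f'.continuous.comp
        continuous_fst)).prodMk (c.continuous.comp continuous_snd))⟩
    ⟨side, hside⟩
    ⟨fun y => p.hom (g' (y.1, y.2.2)).1.1, p.hom.hom.continuous.comp
      (continuous_fst.comp (continuous_subtype_val.comp (g'.continuous.comp (by fun_prop))))⟩
    (fun x v => by
      rcases hsph v with ⟨h, h'⟩ | ⟨h, h'⟩
      · simp [side, h, hfg', h']
      · simp [side, h, hfg', h'])
    (fun x v => by
      change p.hom ((f' x).1 (c v)) = p.hom (g' (x, 0)).1.1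
      rw [hfg', (f' x).2])
    (fun x v t => by
      rcases hsph v with ⟨h, h'⟩ | ⟨h, h'⟩
      · simp [side, h]
      · simpa [side, h] using (g' (x, t)).2.symm)
  let G : C(X × I, C(I, Z.V)) := ContinuousMap.curry
    ⟨fun y : (X × I) × I => L (y.1.1, d y.2, y.1.2), by fun_prop⟩
  have hG : ∀ y s, p.hom (G y s) = p.hom (g' y).1.1 := fun y s => hL _
  have hpt : ∀ v : USphere ℝ, ∀ x t, L (x, sphereToBall v, t) = side (x, v, t) :=
    fun v x t => hLs x v t
  refine ⟨⟨fun y => (⟨G y, fun s => by rw [hG, hG]⟩ : PathSet p),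
    G.continuous.subtype_mk _⟩, fun x => ?_, fun y => ?_⟩
  · refine Subtype.ext (ContinuousMap.ext fun s => ?_)
    change L (x, d s, 0) = (f' x).1 s
    rw [hL₀]
    change (f' x).1 (c (d s)) = _
    rw [hcd]
  · change (⟨(G y 0, G y 1), _⟩ : KerSet p) = g' y
    refine Subtype.ext (Prod.ext ?_ ?_)
    · have hd : d 0 = sphereToBall ⟨-1, by simp⟩ := Subtype.ext (by simp [d, sphereToBall])
      change L (y.1, d 0, y.2) = _
      rw [hd, hpt]
      simp [side]
    · have hd : d 1 = sphereToBall ⟨1, by simp⟩ :=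
        Subtype.ext (by simp [d, sphereToBall]; norm_num)
      change L (y.1, d 1, y.2) = _
      rw [hd, hpt]
      simp [side]

/-- Relative homotopy lifting: a homotopy along the fibres of `p` which is given on the boundary of
a disk, and whose end is given on the whole disk, extends to the disk. -/
lemma hasLiftingProperty_pathEnd (hp : IsMFibration p) (n : ℕ) :
    HasLiftingProperty (TopCat.diskBoundaryInclusion.{u} n) (pathEnd p).hom := by
  refine ⟨fun {f g} sq => ?_⟩
  let f' : C(∂𝔻 n, PathSet p) := f.hom
  let g' : C(𝔻 n, Z.V) := g.hom
  have hw : ∀ v : ∂𝔻 n, (f' v).1 1 = g' (TopCat.diskBoundaryInclusion n v) := fun v =>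
    ConcreteCategory.congr_hom sq.w v
  let V := EuclideanSpace ℝ (Fin n)
  let upS : C(USphere V, ∂𝔻 n) := ⟨fun v => ULift.up v, continuous_uliftUp⟩
  let upB : C(UBall V, 𝔻 n) := ⟨fun v => ULift.up v, continuous_uliftUp⟩
  obtain ⟨L, hL, hL₀, hLs⟩ := hp.exists_cylinder_lift (V := V) (X := PUnit.{u + 1})
    ⟨fun y => g' (upB y.2), by fun_prop⟩
    ⟨fun y => (f' (upS y.2.1)).1 (σ y.2.2), by
      exact continuous_eval.comp ((continuous_subtype_val.comp (f'.continuous.comp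
        (by fun_prop))).prodMk (by fun_prop))⟩
    ⟨fun y => p.hom (g' (upB y.2.1)), p.hom.hom.continuous.comp (by fun_prop)⟩
    (fun x v => by
      change (f' (upS v)).1 (σ 0) = g' (upB (sphereToBall v))
      rw [unitInterval.symm_zero, hw]; rfl)
    (fun x v => rfl)
    (fun x v t => by
      change p.hom ((f' (upS v)).1 (σ t)) = p.hom (g' (upB (sphereToBall v)))
      rw [(f' (upS v)).2, ← (f' (upS v)).2 1, hw]; rfl)
  let down : C(𝔻 n, UBall V) := ⟨fun v => ULift.down v, continuous_uliftDown⟩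
  let G : C(𝔻 n, C(I, Z.V)) := ContinuousMap.curry
    ⟨fun y : 𝔻 n × I => L (PUnit.unit, down y.1, σ y.2), by fun_prop⟩
  refine ⟨⟨⟨TopCat.ofHom ⟨fun y => (⟨G y, fun s => ?_⟩ : PathSet p), G.continuous.subtype_mk _⟩,
    ?_, ?_⟩⟩⟩
  · change p.hom (L (PUnit.unit, _, σ s)) = p.hom (L (PUnit.unit, _, σ 0))
    exact (hL (PUnit.unit, _, σ s)).trans (hL (PUnit.unit, _, σ 0)).symm
  · refine TopCat.ext fun v => Subtype.ext (ContinuousMap.ext fun s => ?_)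
    refine (hLs PUnit.unit (ULift.down v) (σ s)).trans ?_
    change (f' v).1 (σ (σ s)) = (f' v).1 s
    rw [unitInterval.symm_symm]
  · refine TopCat.ext fun v => ?_
    change L (PUnit.unit, _, σ 1) = g' v
    rw [unitInterval.symm_one, hL₀]
    rfl

end PathObjects

/-! ### Points of geometric realizations -/

section Realization

/-- The realization of a coproduct of simplicial sets is the disjoint union of the realizations. -/
noncomputable def sigmaRealizationIso {P : Type u} (F : P → SSet.{u}) :
    TopCat.of (Σ p, (SSet.toTop.obj (F p))) ≅ SSet.toTop.obj (∐ F) :=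
  (TopCat.sigmaCofanIsColimit.{u, u} fun p => SSet.toTop.obj (F p)).coconePointUniqueUpToIso
    (isColimitCofanMkObjOfIsColimit SSet.toTop F _ (coproductIsCoproduct F))

lemma sigmaRealizationIso_hom_apply {P : Type u} (F : P → SSet.{u}) (p : P)
    (x : SSet.toTop.obj (F p)) :
    (sigmaRealizationIso F).hom ⟨p, x⟩ = SSet.toTop.map (Sigma.ι F p) x :=
  ConcreteCategory.congr_hom ((TopCat.sigmaCofanIsColimit.{u, u}
    fun p => SSet.toTop.obj (F p)).comp_coconePointUniqueUpToIso_hom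
    (isColimitCofanMkObjOfIsColimit SSet.toTop F _ (coproductIsCoproduct F)) ⟨p⟩) x

/-- The point of `|X|` with coordinates `z` in the simplex `x`. -/
noncomputable def realPt (X : SSet.{u}) {k : ℕ} (x : X _⦋k⦌) (z : stdSimplex ℝ (Fin (k + 1))) :
    SSet.toTop.obj X :=
  SSet.toTop.map (SSet.yonedaEquiv.symm x) ((SimplexCategory.mk k).toTopHomeo.symm z)

lemma realPt_map (X : SSet.{u}) {k l : ℕ} (f : ⦋k⦌ ⟶ ⦋l⦌) (x : X _⦋l⦌)
    (z : stdSimplex ℝ (Fin (k + 1))) :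
    realPt X (X.map f.op x) z = realPt X x (stdSimplex.map f z) := by
  have h := SimplexCategory.toTopHomeo_symm_naturality_apply.{u} f z
  refine Eq.trans ?_ (congrArg (SSet.toTop.map (SSet.yonedaEquiv.symm x)) h.symm)
  rw [realPt, ← SSet.yonedaEquiv_symm_naturality_left, SSet.toTop.map_comp]
  rfl

lemma map_realPt {X Y : SSet.{u}} (g : X ⟶ Y) {k : ℕ} (x : X _⦋k⦌)
    (z : stdSimplex ℝ (Fin (k + 1))) :
    SSet.toTop.map g (realPt X x z) = realPt Y (g.app _ x) z := by
  rw [realPt, realPt, ← SSet.yonedaEquiv_symm_comp, SSet.toTop.map_comp]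
  rfl

lemma toTopHomeo_realPt {n k : ℕ} (f : ⦋k⦌ ⟶ ⦋n⦌) (z : stdSimplex ℝ (Fin (k + 1))) :
    (SimplexCategory.mk n).toTopHomeo
        (realPt (Δ[n] : SSet.{u}) (SSet.stdSimplex.objEquiv.symm f) z) =
      stdSimplex.map f z := by
  have h := SimplexCategory.toTopHomeo_naturality_apply.{u} f
    ((SimplexCategory.mk k).toTopHomeo.symm z)
  rw [Homeomorph.apply_symm_apply] at h
  rw [← h, realPt, ← SSet.yonedaEquiv_map, Equiv.symm_apply_apply]

/-- The realization of a simplicial set is covered by its nondegenerate simplices. -/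
lemma surjective_sigma_realization (X : SSet.{u}) :
    Function.Surjective fun y : Σ s : X.N, SSet.toTop.obj (Δ[s.dim] : SSet.{u}) =>
      SSet.toTop.map (SSet.yonedaEquiv.symm y.1.simplex) y.2 := by
  let F : X.N → SSet.{u} := fun s => Δ[s.dim]
  let d : ∐ F ⟶ X := Sigma.desc fun s : X.N => SSet.yonedaEquiv.symm s.simplex
  have hd : ∀ s, Sigma.ι F s ≫ d = SSet.yonedaEquiv.symm s.simplex := fun s => by simp [d]
  have : Epi d := by
    rw [← SSet.Subcomplex.range_eq_top_iff, SSet.Subcomplex.eq_top_iff_contains_nonDegenerate]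
    intro n x hx
    have h := congrArg (fun f => SSet.yonedaEquiv f) (hd (SSet.N.mk x hx))
    rw [Equiv.apply_symm_apply] at h
    exact ⟨SSet.yonedaEquiv (Sigma.ι F (SSet.N.mk x hx)), h⟩
  intro x
  obtain ⟨y, rfl⟩ := (TopCat.epi_iff_surjective _).1 (inferInstance : Epi (SSet.toTop.map d)) x
  obtain ⟨⟨s, z⟩, rfl⟩ := (TopCat.homeoOfIso (sigmaRealizationIso F)).surjective y
  refine ⟨⟨s, z⟩, ?_⟩
  change SSet.toTop.map (SSet.yonedaEquiv.symm s.simplex) z =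
    SSet.toTop.map d ((sigmaRealizationIso F).hom ⟨s, z⟩)
  rw [sigmaRealizationIso_hom_apply, ← hd, SSet.toTop.map_comp]
  rfl

lemma exists_realPt (X : SSet.{u}) (p : SSet.toTop.obj X) :
    ∃ (k : ℕ) (x : X _⦋k⦌) (z : stdSimplex ℝ (Fin (k + 1))), p = realPt X x z := by
  obtain ⟨⟨s, w⟩, rfl⟩ := surjective_sigma_realization X p
  exact ⟨s.dim, s.simplex, (SimplexCategory.mk s.dim).toTopHomeo w, by
    rw [realPt, Homeomorph.symm_apply_apply]⟩

lemma compactSpace_realization (X : SSet.{u}) [X.Finite] : CompactSpace (SSet.toTop.obj X) := by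
  have (n : ℕ) : CompactSpace (SSet.toTop.obj (Δ[n] : SSet.{u})) :=
    (SimplexCategory.mk n).toTopHomeo.symm.compactSpace
  exact (surjective_sigma_realization X).compactSpace
    (continuous_sigma fun s => (SSet.toTop.map (SSet.yonedaEquiv.symm s.simplex)).hom.continuous)

end Realization

section StdSimplex

lemma map_apply_eq_sum {m n : ℕ} (f : Fin (m + 1) → Fin (n + 1)) (z : stdSimplex ℝ (Fin (m + 1)))
    (j : Fin (n + 1)) : stdSimplex.map f z j = ∑ i with f i = j, z i := by
  rw [stdSimplex.map_coe, FunOnFinite.linearMap_apply_apply]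

lemma map_apply_of_injective {m n : ℕ} {f : Fin (m + 1) → Fin (n + 1)} (hf : Function.Injective f)
    (z : stdSimplex ℝ (Fin (m + 1))) (i : Fin (m + 1)) : stdSimplex.map f z (f i) = z i := by
  rw [map_apply_eq_sum, Finset.sum_eq_single i]
  · simp +contextual [hf.eq_iff]
  · simp

lemma map_apply_pos_iff {m n : ℕ} (f : Fin (m + 1) → Fin (n + 1))
    {z : stdSimplex ℝ (Fin (m + 1))} (hz : ∀ i, 0 < z i) (j : Fin (n + 1)) :
    0 < stdSimplex.map f z j ↔ j ∈ Set.range f := by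
  rw [map_apply_eq_sum]
  constructor
  · intro h
    by_contra hj
    rw [Finset.sum_eq_zero fun i hi => absurd ⟨i, (Finset.mem_filter.1 hi).2⟩ hj] at h
    exact lt_irrefl _ h
  · rintro ⟨i, rfl⟩
    exact Finset.sum_pos (fun i _ => hz i) ⟨i, by simp⟩

/-- Every point of a simplex is an interior point of one of its faces. -/
lemma exists_map_mono {n : ℕ} (w : stdSimplex ℝ (Fin (n + 1))) :
    ∃ (k : ℕ) (f : ⦋k⦌ ⟶ ⦋n⦌) (_ : Mono f) (z : stdSimplex ℝ (Fin (k + 1))),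
      (∀ i, 0 < z i) ∧ stdSimplex.map f z = w := by
  classical
  let s : Finset (Fin (n + 1)) := {i | 0 < w i}
  have hs : s.card ≠ 0 := fun h => by
    have h0 : ∀ i, w i = 0 := fun i => le_antisymm (not_lt.1 fun hi => by
      rw [Finset.card_eq_zero] at h
      exact Finset.notMem_empty i (h ▸ Finset.mem_filter.2 ⟨Finset.mem_univ i, hi⟩)) (by simp)
    have := stdSimplex.sum_eq_one w
    simp [h0] at this
  obtain ⟨k, hk⟩ := Nat.exists_eq_succ_of_ne_zero hs
  let e := s.orderEmbOfFin hk
  have hsum : ∑ i, w (e i) = 1 := by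
    rw [← stdSimplex.sum_eq_one w, ← Finset.sum_subset (Finset.subset_univ s)
      (fun i _ hi => le_antisymm (not_lt.1 fun h => hi (by simpa [s] using h)) (by simp))]
    refine (Finset.sum_map Finset.univ e.toEmbedding w).symm.trans
      (Finset.sum_congr ?_ fun _ _ => rfl)
    ext i
    simp [e]
  let z : stdSimplex ℝ (Fin (k + 1)) := ⟨fun i => w (e i), fun i => by simp, hsum⟩
  let f : ⦋k⦌ ⟶ ⦋n⦌ := SimplexCategory.Hom.mk e.toOrderHom
  have hf : Function.Injective (f : Fin (k + 1) → Fin (n + 1)) := e.injective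
  refine ⟨k, f, SimplexCategory.mono_iff_injective.2 hf, z, fun i => ?_, ?_⟩
  · exact (Finset.mem_filter.1 (s.orderEmbOfFin_mem hk i)).2
  · refine stdSimplex.ext (funext fun j => ?_)
    by_cases hj : j ∈ s
    · have : j ∈ Set.range e := by rw [Finset.range_orderEmbOfFin]; exact hj
      obtain ⟨i, rfl⟩ := this
      exact map_apply_of_injective hf z i
    · have h1 : w j = 0 := le_antisymm (not_lt.1 fun h => hj (by simpa [s] using h)) (by simp)
      rw [h1, map_apply_eq_sum]
      refine Finset.sum_eq_zero fun i hi => absurd ?_ hj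
      rw [← (Finset.mem_filter.1 hi).2]
      exact s.orderEmbOfFin_mem hk i

/-- A monomorphism of the simplex category is determined by its range. -/
lemma mono_eq_of_range_eq {k l n : ℕ} (f : ⦋k⦌ ⟶ ⦋n⦌) (g : ⦋l⦌ ⟶ ⦋n⦌) [Mono f] [Mono g]
    (h : Set.range (f : Fin (k + 1) → Fin (n + 1)) = Set.range (g : Fin (l + 1) → Fin (n + 1))) :
    ∃ e : k = l, f = eqToHom (by rw [e]) ≫ g := by
  have hf := SimplexCategory.mono_iff_injective.1 (inferInstance : Mono f)
  have hg := SimplexCategory.mono_iff_injective.1 (inferInstance : Mono g)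
  have hkl : k = l := by
    have h1 := Nat.card_range_of_injective hf
    have h2 := Nat.card_range_of_injective hg
    have h3 := congrArg (fun s : Set (Fin (n + 1)) => Nat.card s) h
    have h4 := h1.symm.trans (h3.trans h2)
    simpa using h4
  subst hkl
  refine ⟨rfl, ?_⟩
  rw [eqToHom_refl, Category.id_comp]
  refine SimplexCategory.Hom.ext _ _ (OrderHom.ext _ _ ?_)
  exact (StrictMono.range_inj (f.toOrderHom.monotone.strictMono_of_injective hf)
    (g.toOrderHom.monotone.strictMono_of_injective hg)).1 h

end StdSimplex

section Subcomplexes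

variable {n : ℕ} (A : (Δ[n] : SSet.{u}).Subcomplex)

/-- Normal form for the points of the realization of a subcomplex of a simplex. -/
lemma exists_realPt_mono (p : SSet.toTop.obj (A : SSet.{u})) :
    ∃ (k : ℕ) (f : ⦋k⦌ ⟶ ⦋n⦌) (_ : Mono f) (hf : SSet.stdSimplex.objEquiv.symm f ∈ A.obj (op ⦋k⦌))
      (z : stdSimplex ℝ (Fin (k + 1))), (∀ i, 0 < z i) ∧
        p = realPt (A : SSet.{u}) ⟨SSet.stdSimplex.objEquiv.symm f, hf⟩ z := by
  obtain ⟨k, ⟨x, hx⟩, w, rfl⟩ := exists_realPt _ p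
  obtain ⟨l, g, _, v, hv, rfl⟩ := exists_map_mono w
  obtain ⟨y, rfl⟩ := SSet.stdSimplex.objEquiv.symm.surjective x
  change ⦋k⦌ ⟶ ⦋n⦌ at y
  -- factor the restriction of the simplex to the face carrying the point as epi followed by mono
  obtain ⟨m, e, i, _, _, hei⟩ : ∃ (m : ℕ) (e : ⦋l⦌ ⟶ ⦋m⦌) (i : ⦋m⦌ ⟶ ⦋n⦌), Epi e ∧ Mono i ∧
      e ≫ i = g ≫ y :=
    ⟨(image (g ≫ y)).len, factorThruImage (g ≫ y), image.ι (g ≫ y), inferInstance, inferInstance,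
      image.fac _⟩
  have hi : SSet.stdSimplex.objEquiv.symm i ∈ A.obj (op ⦋m⦌) := by
    obtain ⟨⟨σ⟩⟩ := isSplitEpi_of_epi e
    have h := A.map (σ.section_ ≫ g).op hx
    have h' : (σ.section_ ≫ g) ≫ y = i := by
      rw [Category.assoc, ← hei, ← Category.assoc, σ.id, Category.id_comp]
    rwa [Set.mem_preimage, SSet.stdSimplex.map_objEquiv_symm, Quiver.Hom.unop_op, h'] at h
  refine ⟨m, i, inferInstance, hi, stdSimplex.map e v, fun j => ?_, ?_⟩
  · exact (map_apply_pos_iff _ hv j).2 (SimplexCategory.epi_iff_surjective.1 inferInstance j)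
  · refine (realPt_map _ g _ v).symm.trans
      (Eq.trans (congrArg (realPt _ · v) ?_) (realPt_map _ e _ v))
    refine Subtype.ext ?_
    change (Δ[n] : SSet.{u}).map g.op (SSet.stdSimplex.objEquiv.symm y) =
      (Δ[n] : SSet.{u}).map e.op (SSet.stdSimplex.objEquiv.symm i)
    rw [SSet.stdSimplex.map_objEquiv_symm, SSet.stdSimplex.map_objEquiv_symm]
    exact congrArg _ hei.symm

/-- The map from the realization of a subcomplex of `Δ[n]` to the topological simplex. -/
noncomputable def toStdSimplex : C(SSet.toTop.obj (A : SSet.{u}), stdSimplex ℝ (Fin (n + 1))) :=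
  ((SimplexCategory.mk n).toTopHomeo : C(_, _)).comp (SSet.toTop.map A.ι).hom

lemma toStdSimplex_realPt {k : ℕ} (f : ⦋k⦌ ⟶ ⦋n⦌)
    (hf : SSet.stdSimplex.objEquiv.symm f ∈ A.obj (op ⦋k⦌)) (z : stdSimplex ℝ (Fin (k + 1))) :
    toStdSimplex A (realPt (A : SSet.{u}) ⟨SSet.stdSimplex.objEquiv.symm f, hf⟩ z) =
      stdSimplex.map f z := by
  rw [← toTopHomeo_realPt.{u} f z]
  exact congrArg (SimplexCategory.mk n).toTopHomeo (map_realPt A.ι ⟨_, hf⟩ z)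

lemma injective_toStdSimplex : Function.Injective (toStdSimplex A) := by
  intro p q h
  obtain ⟨k, f, _, hf, z, hz, rfl⟩ := exists_realPt_mono A p
  obtain ⟨l, g, _, hg, w, hw, rfl⟩ := exists_realPt_mono A q
  rw [toStdSimplex_realPt, toStdSimplex_realPt] at h
  obtain ⟨rfl, hfg⟩ := mono_eq_of_range_eq f g (Set.ext fun j => by
    rw [← map_apply_pos_iff _ hz j, ← map_apply_pos_iff _ hw j, h])
  obtain rfl : f = g := by simpa using hfg
  have hinj := SimplexCategory.mono_iff_injective.1 (inferInstance : Mono f)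
  obtain rfl : z = w := stdSimplex.ext (funext fun i => by
    rw [← map_apply_of_injective hinj z i, ← map_apply_of_injective hinj w i]
    exact congrArg (fun v : stdSimplex ℝ (Fin (n + 1)) => v _) h)
  rfl

lemma isClosedEmbedding_toStdSimplex : Topology.IsClosedEmbedding (toStdSimplex A) := by
  have := compactSpace_realization (A : SSet.{u})
  exact (toStdSimplex A).continuous.isClosedEmbedding (injective_toStdSimplex A)

lemma range_toStdSimplex (S : Set (Fin (n + 1)))
    (hA : ∀ (k : ℕ) (f : ⦋k⦌ ⟶ ⦋n⦌), SSet.stdSimplex.objEquiv.symm f ∈ A.obj (op ⦋k⦌) ↔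
      ∃ j ∈ S, j ∉ Set.range (f : Fin (k + 1) → Fin (n + 1))) :
    Set.range (toStdSimplex A) = {w | ∃ j ∈ S, w j = 0} := by
  ext w
  constructor
  · rintro ⟨p, rfl⟩
    obtain ⟨k, f, _, hf, z, hz, rfl⟩ := exists_realPt_mono A p
    obtain ⟨j, hjS, hj⟩ := (hA k f).1 hf
    refine ⟨j, hjS, ?_⟩
    rw [toStdSimplex_realPt]
    exact le_antisymm (not_lt.1 fun h => hj ((map_apply_pos_iff _ hz j).1 h))
      (stdSimplex.zero_le _ _)
  · rintro ⟨j, hjS, hj⟩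
    obtain ⟨k, f, _, z, hz, rfl⟩ := exists_map_mono w
    have hf : SSet.stdSimplex.objEquiv.symm f ∈ A.obj (op ⦋k⦌) := (hA k f).2 ⟨j, hjS, fun h => by
      have := (map_apply_pos_iff _ hz j).2 h
      rw [hj] at this
      exact lt_irrefl _ this⟩
    exact ⟨_, toStdSimplex_realPt A f hf z⟩

end Subcomplexes

/-! ### Horns, boundaries and disks -/

section Horns

open unitInterval

variable {n : ℕ}

lemma range_toStdSimplex_horn (i : Fin (n + 2)) :
    Set.range (toStdSimplex (Λ[n + 1, i] : (Δ[n + 1] : SSet.{u}).Subcomplex)) =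
      {w | ∃ j, w (i.succAbove j) = 0} := by
  rw [range_toStdSimplex _ {i}ᶜ fun k f => by
    rw [SSet.mem_horn_iff_notMem_range]
    simp only [Set.mem_compl_singleton_iff, exists_prop]
    rfl]
  ext w
  constructor
  · rintro ⟨j, hj, hw⟩
    obtain ⟨j, rfl⟩ := Fin.exists_succAbove_eq hj
    exact ⟨j, hw⟩
  · rintro ⟨j, hj⟩
    exact ⟨_, Fin.succAbove_ne i j, hj⟩

lemma range_toStdSimplex_boundary :
    Set.range (toStdSimplex (∂Δ[n] : (Δ[n] : SSet.{u}).Subcomplex)) = {w | ∃ j, w j = 0} := by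
  rw [range_toStdSimplex _ Set.univ fun k f => by
    rw [SSet.mem_boundary_iff_notMem_range]
    simp only [Set.mem_univ, true_and]
    rfl]
  simp

/-- The smallest coordinate of a point of the simplex, the coordinate `i` excepted: this measures
how far the point is from the horn `Λ[n + 1, i]`. -/
noncomputable def minCoord (i : Fin (n + 2)) (w : stdSimplex ℝ (Fin (n + 2))) : ℝ :=
  Finset.univ.inf' Finset.univ_nonempty fun j : Fin (n + 1) => w (i.succAbove j)

lemma continuous_minCoord (i : Fin (n + 2)) : Continuous (minCoord i) :=
  Continuous.finset_inf'_apply _ fun _ _ => (continuous_apply _).comp continuous_subtype_val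

lemma minCoord_le (i : Fin (n + 2)) (w : stdSimplex ℝ (Fin (n + 2))) (j : Fin (n + 1)) :
    minCoord i w ≤ w (i.succAbove j) :=
  Finset.inf'_le _ (Finset.mem_univ j)

lemma minCoord_nonneg (i : Fin (n + 2)) (w : stdSimplex ℝ (Fin (n + 2))) : 0 ≤ minCoord i w :=
  Finset.le_inf' _ _ fun _ _ => stdSimplex.zero_le _ _

lemma minCoord_le_one (i : Fin (n + 2)) (w : stdSimplex ℝ (Fin (n + 2))) : minCoord i w ≤ 1 :=
  (minCoord_le i w 0).trans (stdSimplex.le_one _ _)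

lemma exists_eq_minCoord (i : Fin (n + 2)) (w : stdSimplex ℝ (Fin (n + 2))) :
    ∃ j, w (i.succAbove j) = minCoord i w := by
  obtain ⟨j, -, hj⟩ := Finset.exists_mem_eq_inf' (s := Finset.univ) Finset.univ_nonempty
    fun j : Fin (n + 1) => w (i.succAbove j)
  exact ⟨j, hj.symm⟩

/-- The coordinates of `w` after lowering each coordinate except the one with index `i` by `c`, the
loss being added to the latter. -/
noncomputable def moveCoord (i : Fin (n + 2)) (w : Fin (n + 2) → ℝ) (c : ℝ) : Fin (n + 2) → ℝ :=
  i.insertNth (w i + (n + 1) * c) fun j => w (i.succAbove j) - c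

/-- The point of the simplex with coordinates `moveCoord i w c`. For `c = minCoord i w`, it lies on
the horn `Λ[n + 1, i]`. -/
noncomputable def moveToHorn (i : Fin (n + 2)) (w : stdSimplex ℝ (Fin (n + 2))) (c : ℝ)
    (h₀ : 0 ≤ c) (h : c ≤ minCoord i w) : stdSimplex ℝ (Fin (n + 2)) :=
  ⟨moveCoord i w c, fun k => by
    induction k using i.succAboveCases with
    | x =>
      have := stdSimplex.zero_le w i
      simp only [moveCoord, Fin.insertNth_apply_same]
      positivity
    | p _ =>
      simp only [moveCoord, Fin.insertNth_apply_succAbove, sub_nonneg]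
      exact h.trans (minCoord_le i w _), by
    have := stdSimplex.sum_eq_one w
    rw [Fin.sum_univ_succAbove _ i] at this ⊢
    simp only [moveCoord, Fin.insertNth_apply_same, Fin.insertNth_apply_succAbove,
      Finset.sum_sub_distrib, Finset.sum_const, Finset.card_univ, Fintype.card_fin, nsmul_eq_mul]
    push_cast
    linarith⟩

lemma moveToHorn_zero (i : Fin (n + 2)) (w : stdSimplex ℝ (Fin (n + 2))) (c : ℝ)
    (h₀ : 0 ≤ c) (h : c ≤ minCoord i w) (hc : c = 0) : moveToHorn i w c h₀ h = w := by
  subst hc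
  refine stdSimplex.ext (funext fun k => ?_)
  change moveCoord i w 0 k = w k
  induction k using i.succAboveCases <;> simp [moveCoord]

lemma continuous_moveToHorn (i : Fin (n + 2)) {X : Type*} [TopologicalSpace X]
    {w : X → stdSimplex ℝ (Fin (n + 2))} {c : X → ℝ} (hw : Continuous w) (hc : Continuous c)
    (h₀ : ∀ x, 0 ≤ c x) (h : ∀ x, c x ≤ minCoord i (w x)) :
    Continuous fun x => moveToHorn i (w x) (c x) (h₀ x) (h x) := by
  refine Continuous.subtype_mk (continuous_pi fun k => ?_) _
  have hk : ∀ k, Continuous fun x => w x k := fun k =>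
    (continuous_apply k).comp (continuous_subtype_val.comp hw)
  induction k using i.succAboveCases with
  | x =>
    simp only [moveCoord, Fin.insertNth_apply_same]
    exact (hk i).add (continuous_const.mul hc)
  | p j =>
    simp only [moveCoord, Fin.insertNth_apply_succAbove]
    exact (hk _).sub hc

/-- Hurewicz fibrations have the right lifting property against the realizations of horn
inclusions. -/
lemma HurewiczFibration.hasLiftingProperty_horn {E B : TopCat.{u}} {p : E ⟶ B}
    (hp : HurewiczFibration p.hom) (i : Fin (n + 2)) :
    HasLiftingProperty (SSet.toTop.map (SSet.horn.{u} (n + 1) i).ι) p := by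
  refine ⟨fun {a b} sq => ?_⟩
  let A : (Δ[n + 1] : SSet.{u}).Subcomplex := SSet.horn.{u} (n + 1) i
  let e : SSet.toTop.obj (Δ[n + 1] : SSet.{u}) ≃ₜ stdSimplex ℝ (Fin (n + 2)) :=
    (SimplexCategory.mk (n + 1)).toTopHomeo
  let h := (isClosedEmbedding_toStdSimplex A).toHomeomorph
  have hmem : ∀ w : stdSimplex ℝ (Fin (n + 2)),
      moveToHorn i w (minCoord i w) (minCoord_nonneg i w) le_rfl ∈ Set.range (toStdSimplex A) := by
    intro w
    rw [range_toStdSimplex_horn]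
    obtain ⟨j, hj⟩ := exists_eq_minCoord i w
    refine ⟨j, ?_⟩
    change moveCoord i w _ _ = 0
    simp [moveCoord, hj]
  let r : C(stdSimplex ℝ (Fin (n + 2)), Set.range (toStdSimplex A)) :=
    ⟨fun w => ⟨_, hmem w⟩, (continuous_moveToHorn i continuous_id (continuous_minCoord i)
      (minCoord_nonneg i) fun _ => le_rfl).subtype_mk _⟩
  have hι : ∀ y : Set.range (toStdSimplex A),
      SSet.toTop.map A.ι (h.symm y) = e.symm y := fun y => by
    rw [← e.symm_apply_apply (SSet.toTop.map A.ι (h.symm y))]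
    exact congrArg e.symm (congrArg Subtype.val (h.apply_symm_apply y))
  have hc₀ : ∀ z : stdSimplex ℝ (Fin (n + 2)) × I, 0 ≤ max (minCoord i z.1 - z.2) 0 :=
    fun z => le_max_right _ _
  have hc₁ : ∀ z : stdSimplex ℝ (Fin (n + 2)) × I, max (minCoord i z.1 - z.2) 0 ≤ minCoord i z.1 :=
    fun z => max_le (by linarith [z.2.2.1]) (minCoord_nonneg i _)
  obtain ⟨G, hG, hG₀⟩ := hp.exists_lift_of_flow e (b.hom.comp (e.symm : C(_, _)))
    ((a.hom.comp (h.symm : C(_, _))).comp r)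
    ⟨fun z => moveToHorn i z.1 (max (minCoord i z.1 - z.2) 0) (hc₀ z) (hc₁ z),
      continuous_moveToHorn i continuous_fst ((((continuous_minCoord i).comp continuous_fst).sub
        (by fun_prop)).max continuous_const) hc₀ hc₁⟩
    ⟨fun w => ⟨minCoord i w, minCoord_nonneg i w, minCoord_le_one i w⟩,
      (continuous_minCoord i).subtype_mk _⟩
    (fun w => by
      refine (ConcreteCategory.congr_hom sq.w (h.symm (r w))).trans ?_
      refine (congrArg b (hι (r w))).trans ?_
      change b (e.symm _) = b (e.symm _)
      congr 2
      simp only [r, ContinuousMap.coe_mk, Set.Icc.coe_zero, sub_zero,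
        max_eq_left (minCoord_nonneg i w)])
    (fun w => moveToHorn_zero i w _ (hc₀ (w, _)) (hc₁ (w, _)) (by simp))
  refine ⟨⟨⟨TopCat.ofHom (G.comp (e : C(_, _))), ?_, ?_⟩⟩⟩
  · refine TopCat.ext fun x => ?_
    have hx : e (SSet.toTop.map A.ι x) ∈ Set.range (toStdSimplex A) := ⟨x, rfl⟩
    have h0 : minCoord i (e (SSet.toTop.map A.ι x)) = 0 := by
      rw [range_toStdSimplex_horn] at hx
      obtain ⟨j, hj⟩ := hx
      exact le_antisymm (hj ▸ minCoord_le i _ j) (minCoord_nonneg i _)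
    refine (hG₀ _ (Subtype.ext h0)).trans ?_
    change a (h.symm (r _)) = a x
    congr 1
    rw [h.symm_apply_eq]
    exact Subtype.ext (moveToHorn_zero _ _ _ (minCoord_nonneg i _) le_rfl h0)
  · refine TopCat.ext fun x => (hG _).trans ?_
    change b (e.symm (e x)) = b x
    rw [e.symm_apply_apply]

end Horns

section Disks

variable (n : ℕ)

/-- The simplex spanned by the origin and the unit vectors of `ℝⁿ`. -/
def cornerSimplex : Set (EuclideanSpace ℝ (Fin n)) := {x | (∀ i, 0 ≤ x i) ∧ ∑ i, x i ≤ 1}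

lemma isClosed_cornerSimplex : IsClosed (cornerSimplex n) := by
  have : cornerSimplex n = (⋂ i, {x | 0 ≤ x i}) ∩ {x | ∑ i, x i ≤ 1} := by
    ext; simp [cornerSimplex]
  rw [this]
  exact (isClosed_iInter fun i => isClosed_le continuous_const (by fun_prop)).inter
    (isClosed_le (by fun_prop) continuous_const)

lemma convex_cornerSimplex : Convex ℝ (cornerSimplex n) := by
  rintro x ⟨hx, hx'⟩ y ⟨hy, hy'⟩ a b ha hb hab
  refine ⟨fun i => ?_, ?_⟩
  · have := hx i
    have := hy i
    simp only [PiLp.add_apply, PiLp.smul_apply, smul_eq_mul]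
    positivity
  · simp only [PiLp.add_apply, PiLp.smul_apply, smul_eq_mul, Finset.sum_add_distrib,
      ← Finset.mul_sum]
    nlinarith

lemma interior_cornerSimplex :
    interior (cornerSimplex n) = {x | (∀ i, 0 < x i) ∧ ∑ i, x i < 1} := by
  refine subset_antisymm (fun x hx => ?_) (interior_maximal (fun x hx => ?_) ?_)
  · -- a point of the interior can be moved by a small multiple of `(1, …, 1)` both ways
    let d : EuclideanSpace ℝ (Fin n) := WithLp.toLp 2 fun _ => 1
    have hcont : Continuous fun t : ℝ => x + t • d := by fun_prop
    have hnhds : (fun t : ℝ => x + t • d) ⁻¹' interior (cornerSimplex n) ∈ nhds (0 : ℝ) :=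
      (isOpen_interior.preimage hcont).mem_nhds (by simpa using hx)
    obtain ⟨ε, hε, h⟩ := Metric.mem_nhds_iff.1 hnhds
    have h₁ : x + (ε / 2) • d ∈ cornerSimplex n := interior_subset (h (by
      rw [mem_ball_zero_iff, Real.norm_eq_abs, abs_of_pos (by linarith)]; linarith))
    have h₂ : x + (-(ε / 2)) • d ∈ cornerSimplex n := interior_subset (h (by
      rw [mem_ball_zero_iff, Real.norm_eq_abs, abs_neg, abs_of_pos (by linarith)]; linarith))
    refine ⟨fun i => ?_, ?_⟩
    · have := h₂.1 i
      simp [d] at this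
      linarith
    · have := h₁.2
      simp [d, Finset.sum_add_distrib] at this
      rcases Nat.eq_zero_or_pos n with rfl | hn
      · simp
      · have : (0 : ℝ) < n * (ε / 2) := by positivity
        linarith
  · exact ⟨fun i => (hx.1 i).le, hx.2.le⟩
  · have h := (isOpen_iInter_of_finite fun i : Fin n => isOpen_lt (continuous_const (y := (0 : ℝ)))
      (by fun_prop : Continuous fun x : EuclideanSpace ℝ (Fin n) => x i)).inter
      (isOpen_lt (by fun_prop : Continuous fun x : EuclideanSpace ℝ (Fin n) => ∑ i, x i)
        (continuous_const (y := (1 : ℝ))))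
    convert h using 1
    ext
    simp

lemma isBounded_cornerSimplex : Bornology.IsBounded (cornerSimplex n) := by
  rw [isBounded_iff_forall_norm_le]
  refine ⟨Real.sqrt n, fun x hx => ?_⟩
  rw [EuclideanSpace.norm_eq]
  refine Real.sqrt_le_sqrt ?_
  have h : ∀ i, ‖x i‖ ^ 2 ≤ 1 := fun i => by
    have h1 : x i ≤ 1 :=
      (Finset.single_le_sum (fun j _ => hx.1 j) (Finset.mem_univ i)).trans hx.2
    rw [Real.norm_of_nonneg (hx.1 i)]
    nlinarith [hx.1 i]
  simpa using Finset.sum_le_sum fun i (_ : i ∈ Finset.univ) => h i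

lemma nonempty_interior_cornerSimplex : (interior (cornerSimplex n)).Nonempty := by
  rw [interior_cornerSimplex]
  refine ⟨WithLp.toLp 2 fun _ => 1 / ((n : ℝ) + 1), fun i => ?_, ?_⟩
  · change 0 < 1 / ((n : ℝ) + 1)
    positivity
  · simp only [Finset.sum_const, Finset.card_univ, Fintype.card_fin, nsmul_eq_mul]
    rw [mul_one_div, div_lt_one (by positivity)]
    linarith

/-- The map from the standard simplex to `ℝⁿ` which forgets the coordinate `0`. -/
noncomputable def dropCoord (w : stdSimplex ℝ (Fin (n + 1))) : EuclideanSpace ℝ (Fin n) :=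
  WithLp.toLp 2 fun i => w i.succ

lemma continuous_dropCoord : Continuous (dropCoord n) :=
  (PiLp.continuous_toLp 2 _).comp
    (continuous_pi fun i => (continuous_apply i.succ).comp continuous_subtype_val)

lemma sum_dropCoord (w : stdSimplex ℝ (Fin (n + 1))) : ∑ i, dropCoord n w i = 1 - w 0 := by
  have := stdSimplex.sum_eq_one w
  rw [Fin.sum_univ_succ] at this
  change ∑ i : Fin n, w i.succ = _
  linarith

lemma injective_dropCoord : Function.Injective (dropCoord n) := by
  intro w w' h
  refine stdSimplex.ext (funext fun i => ?_)
  induction i using Fin.cases with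
  | zero =>
    have h1 := sum_dropCoord n w
    have h2 := sum_dropCoord n w'
    rw [h] at h1
    change w 0 = w' 0
    linarith
  | succ i => exact congrArg (fun x : EuclideanSpace ℝ (Fin n) => x i) h

lemma range_dropCoord : Set.range (dropCoord n) = cornerSimplex n := by
  refine subset_antisymm ?_ fun x hx => ?_
  · rintro _ ⟨w, rfl⟩
    refine ⟨fun i => stdSimplex.zero_le w i.succ, ?_⟩
    rw [sum_dropCoord]
    linarith [stdSimplex.zero_le w 0]
  · refine ⟨⟨Fin.cons (1 - ∑ i, x i) x.ofLp, fun i => ?_, ?_⟩, ?_⟩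
    · induction i using Fin.cases with
      | zero => simpa using hx.2
      | succ i => exact hx.1 i
    · rw [Fin.sum_univ_succ]
      simp
    · rfl

lemma dropCoord_mem_frontier_iff (w : stdSimplex ℝ (Fin (n + 1))) :
    dropCoord n w ∈ frontier (cornerSimplex n) ↔ ∃ j, w j = 0 := by
  have hw : dropCoord n w ∈ cornerSimplex n := range_dropCoord n ▸ ⟨w, rfl⟩
  rw [(isClosed_cornerSimplex n).frontier_eq, interior_cornerSimplex, Set.mem_sdiff,
    and_iff_right hw, Set.mem_ofPred_eq, sum_dropCoord]
  rw [← not_iff_not, not_not, not_exists, Fin.forall_fin_succ, and_comm]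
  refine and_congr ?_ (forall_congr' fun i => ?_)
  · rw [sub_lt_self_iff]
    exact ⟨ne_of_gt, (stdSimplex.zero_le w 0).lt_of_ne'⟩
  · exact ⟨ne_of_gt, (stdSimplex.zero_le w i.succ).lt_of_ne'⟩

/-- The pair formed by the standard simplex and its boundary is homeomorphic to the pair formed by
the closed unit ball and the unit sphere. -/
lemma exists_simplex_to_ball :
    ∃ f : C(stdSimplex ℝ (Fin (n + 1)), EuclideanSpace ℝ (Fin n)), Function.Injective f ∧
      Set.range f = Metric.closedBall 0 1 ∧ ∀ w, f w ∈ Metric.sphere 0 1 ↔ ∃ j, w j = 0 := by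
  obtain ⟨h, -, h₁, h₂⟩ := exists_homeomorph_image_interior_closure_frontier_eq_unitBall
    (convex_cornerSimplex n) (nonempty_interior_cornerSimplex n) (isBounded_cornerSimplex n)
  refine ⟨⟨h ∘ dropCoord n, h.continuous.comp (continuous_dropCoord n)⟩,
    h.injective.comp (injective_dropCoord n), ?_, fun w => ?_⟩
  · change Set.range (h ∘ dropCoord n) = _
    rw [Set.range_comp, range_dropCoord, ← h₁, (isClosed_cornerSimplex n).closure_eq]
  · rw [← h₂, ← dropCoord_mem_frontier_iff]
    exact h.injective.mem_set_image

/-- The realization of the boundary inclusion of a simplex is isomorphic to the inclusion of the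
boundary of a disk. -/
lemma exists_iso_diskBoundaryInclusion :
    ∃ (α : SSet.toTop.obj (SSet.boundary.{u} n : SSet.{u}) ≅ ∂𝔻 n)
      (β : SSet.toTop.obj (Δ[n] : SSet.{u}) ≅ 𝔻 n),
      α.hom ≫ TopCat.diskBoundaryInclusion n = SSet.toTop.map (SSet.boundary.{u} n).ι ≫ β.hom := by
  obtain ⟨f, hf, hf₁, hf₂⟩ := exists_simplex_to_ball n
  let e : SSet.toTop.obj (Δ[n] : SSet.{u}) ≃ₜ stdSimplex ℝ (Fin (n + 1)) :=
    (SimplexCategory.mk n).toTopHomeo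
  let t := toStdSimplex (SSet.boundary.{u} n)
  have ht : ∀ x, ∃ j, t x j = 0 := fun x => by
    have : t x ∈ Set.range t := ⟨x, rfl⟩
    rwa [range_toStdSimplex_boundary] at this
  have := compactSpace_realization (SSet.boundary.{u} n : SSet.{u})
  have := e.symm.compactSpace
  let b : SSet.toTop.obj (Δ[n] : SSet.{u}) → 𝔻 n := fun x =>
    ULift.up ⟨f (e x), by rw [← hf₁]; exact ⟨_, rfl⟩⟩
  have hb : IsHomeomorph b := by
    have : T2Space (𝔻 n : TopCat.{u}) := inferInstanceAs (T2Space (ULift _))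
    rw [isHomeomorph_iff_continuous_bijective]
    refine ⟨continuous_uliftUp.comp ((f.continuous.comp e.continuous).subtype_mk _),
      fun x y h => e.injective (hf (congrArg (fun z : 𝔻 n => (ULift.down z).1) h)), ?_⟩
    rintro ⟨y, hy⟩
    rw [← hf₁] at hy
    obtain ⟨w, rfl⟩ := hy
    exact ⟨e.symm w, congrArg ULift.up (Subtype.ext (congrArg f (e.apply_symm_apply w)))⟩
  let a : SSet.toTop.obj (SSet.boundary.{u} n : SSet.{u}) → ∂𝔻 n := fun x =>
    ULift.up ⟨f (t x), (hf₂ _).2 (ht x)⟩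
  have ha : IsHomeomorph a := by
    have : T2Space (∂𝔻 n : TopCat.{u}) := inferInstanceAs (T2Space (ULift _))
    rw [isHomeomorph_iff_continuous_bijective]
    refine ⟨continuous_uliftUp.comp ((f.continuous.comp t.continuous).subtype_mk _),
      fun x y h => injective_toStdSimplex _ (hf (congrArg (fun z : ∂𝔻 n => (ULift.down z).1) h)),
      ?_⟩
    rintro ⟨y, hy⟩
    have hy' := Metric.sphere_subset_closedBall hy
    rw [← hf₁] at hy'
    obtain ⟨w, rfl⟩ := hy'
    have hw : w ∈ Set.range t := by
      rw [range_toStdSimplex_boundary]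
      exact (hf₂ w).1 hy
    obtain ⟨x, rfl⟩ := hw
    exact ⟨x, rfl⟩
  exact ⟨TopCat.isoOfHomeo (ha.homeomorph), TopCat.isoOfHomeo (hb.homeomorph), rfl⟩

end Disks

/-! ### Maps out of `P × T` -/

section CellSpaces

variable {M : Type u} [Monoid M]

/-- The map of `M`-spaces `P × T ⟶ Z` given by a compatible family of maps `T ⟶ Z`. -/
def cellSpaceDesc {P : Type u} [MulAction M P] {T : TopCat.{u}} {Z : Action TopCat.{u} M}
    (φ : P → (T ⟶ Z.V)) (hφ : ∀ (m : M) (p : P) (t : T), φ (m • p) t = actPt Z m (φ p t)) :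
    cellSpace M P T ⟶ Z :=
  mkMHom (X := cellSpace M P T) (Y := Z)
    ⟨fun x : Σ _ : P, T => φ x.1 x.2, continuous_sigma fun p => (φ p).hom.continuous⟩
    (fun m x => hφ m x.1 x.2)

/-- If `P` is a free `M`-set, then a lift in each basis cell determines a lift of `M`-spaces. -/
lemma hasLiftingProperty_cellSpaceMap {P : Type u} [MulAction M P] {A : Set P}
    (hA : IsFreeBasis M A) {S T : TopCat.{u}} (j : S ⟶ T) {Z B : Action TopCat.{u} M} (p : Z ⟶ B)
    [HasLiftingProperty j p.hom] : HasLiftingProperty (cellSpaceMap M P j) p := by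
  refine ⟨fun {f g} sq => ?_⟩
  let F (a : P) : S ⟶ Z.V := TopCat.ofHom
    ⟨fun s => f.hom (show (Σ _ : P, S) from ⟨a, s⟩),
      f.hom.hom.continuous.comp (continuous_sigmaMk (σ := fun _ : P => S))⟩
  let G (a : P) : T ⟶ B.V := TopCat.ofHom
    ⟨fun s => g.hom (show (Σ _ : P, T) from ⟨a, s⟩),
      g.hom.hom.continuous.comp (continuous_sigmaMk (σ := fun _ : P => T))⟩
  have hsq (a : P) : CommSq (F a) j p.hom (G a) := ⟨TopCat.ext fun s =>
    ConcreteCategory.congr_hom (congrArg Action.Hom.hom sq.w) (⟨a, s⟩ : Σ _ : P, S)⟩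
  choose c hc hu using hA
  have hcm (m : M) (x : P) : c (m • x) = (m * (c x).1, (c x).2) :=
    (hu _ (m * (c x).1, (c x).2) ⟨(hc x).1, by rw [mul_smul, (hc x).2]⟩).symm
  have hF (m : M) (x : P) (s : S) : F (m • x) s = actPt Z m (F x s) :=
    hom_actPt f m (show (Σ _ : P, S) from ⟨x, s⟩)
  have hG (m : M) (x : P) (s : T) : G (m • x) s = actPt B m (G x s) :=
    hom_actPt g m (show (Σ _ : P, T) from ⟨x, s⟩)
  let φ (x : P) : T ⟶ Z.V := (hsq (c x).2).lift ≫ (show Z.V ⟶ Z.V from Z.ρ (c x).1)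
  refine ⟨⟨⟨cellSpaceDesc φ fun m x t => ?_, ?_, ?_⟩⟩⟩
  · change actPt Z (c (m • x)).1 ((hsq (c (m • x)).2).lift t) =
      actPt Z m (actPt Z (c x).1 ((hsq (c x).2).lift t))
    rw [hcm, actPt_mul]
  · refine mhom_ext fun y : Σ _ : P, S => ?_
    obtain ⟨x, s⟩ := y
    change actPt Z (c x).1 ((hsq (c x).2).lift (j s)) = F x s
    rw [← TopCat.comp_app, (hsq (c x).2).fac_left, ← hF, (hc x).2]
  · refine mhom_ext fun y : Σ _ : P, T => ?_
    obtain ⟨x, t⟩ := y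
    change p.hom (actPt Z (c x).1 ((hsq (c x).2).lift t)) = G x t
    rw [hom_actPt, ← TopCat.comp_app, (hsq (c x).2).fac_right, ← hG, (hc x).2]

end CellSpaces

/-! ### Realizations of stable subcomplexes -/

section StableSubcomplexes

variable {M : Type u} [Monoid M] (K : Action SSet.{u} M)

/-- The action of `m ∈ M` on `K` as a morphism of simplicial sets. -/
abbrev actHom (m : M) : K.V ⟶ K.V := K.ρ m

lemma actSimplex_one {n : ℕ} (x : K.V _⦋n⦌) : actSimplex K 1 x = x := by
  simp only [actSimplex, map_one]; rfl

lemma actSimplex_mul {n : ℕ} (m m' : M) (x : K.V _⦋n⦌) :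
    actSimplex K (m * m') x = actSimplex K m (actSimplex K m' x) := by
  simp only [actSimplex, map_mul]; rfl

lemma map_actSimplex {k n : ℕ} (f : ⦋k⦌ ⟶ ⦋n⦌) (m : M) (x : K.V _⦋n⦌) :
    K.V.map f.op (actSimplex K m x) = actSimplex K m (K.V.map f.op x) :=
  (ConcreteCategory.congr_hom ((actHom K m).naturality f.op) x).symm

/-- The subcomplexes of `K` which are stable under the action of `M`. -/
abbrev StableSub : Type u :=
  {L : K.V.Subcomplex // ∀ (m : M) (n : ℕ) (x : K.V _⦋n⦌),
    x ∈ L.obj (op ⦋n⦌) → actSimplex K m x ∈ L.obj (op ⦋n⦌)}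

variable {K}

/-- The action of `m ∈ M` on a stable subcomplex. -/
def StableSub.actHom (L : StableSub K) (m : M) : (L.1 : SSet.{u}) ⟶ (L.1 : SSet.{u}) :=
  SSet.Subcomplex.lift (L.1.ι ≫ MonoidCW.actHom K m) (by
    rintro ⟨⟨n⟩⟩ _ ⟨x, rfl⟩
    exact L.2 m n x.1 x.2)

/-- A stable subcomplex as an `M`-simplicial set. -/
def StableSub.toAction (L : StableSub K) : Action SSet.{u} M where
  V := L.1
  ρ :=
    { toFun := fun m => L.actHom m
      map_one' := by
        rw [← cancel_mono L.1.ι]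
        change L.1.ι ≫ K.ρ 1 = L.1.ι
        rw [map_one]
        rfl
      map_mul' := fun m m' => by
        rw [← cancel_mono L.1.ι]
        change L.1.ι ≫ K.ρ (m * m') = L.1.ι ≫ K.ρ m' ≫ K.ρ m
        rw [map_mul]
        rfl }

variable (K) in
/-- The functor sending a stable subcomplex to the associated `M`-simplicial set. -/
def stableSubFunctor : StableSub K ⥤ Action SSet.{u} M where
  obj L := L.toAction
  map {L L'} h := { hom := SSet.Subcomplex.homOfLE (leOfHom h), comm := fun _ => rfl }

variable (K) in
/-- The functor sending a stable subcomplex to its realization. -/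
noncomputable def realSub : StableSub K ⥤ Action TopCat.{u} M :=
  stableSubFunctor K ⋙ SSet.toTop.mapAction M

variable (K) in
/-- The inclusion of the realization of a stable subcomplex. -/
noncomputable def realSubι : realSub K ⟶ (Functor.const _).obj (realization K) where
  app L := (SSet.toTop.mapAction M).map { hom := L.1.ι, comm := fun _ => rfl }
  naturality {L L'} h := by
    refine ((SSet.toTop.mapAction M).map_comp _ _).symm.trans ?_
    exact (Category.comp_id _).symm

/-- The realization of `K` is the colimit of the realizations of the members of an exhausting
sequence of stable subcomplexes. -/
noncomputable def isColimitRealSub (F : ℕ →o StableSub K) (hF : ∀ n, ∀ x : K.V _⦋n⦌,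
    ∃ k, x ∈ (F k).1.obj (op ⦋n⦌)) :
    IsColimit (Cocone.mk (realization K) (F.monotone.functor.whiskerLeft (realSubι K))) := by
  let F' : ℕ →o K.V.Subcomplex := ⟨fun n => (F n).1, fun _ _ h => F.monotone h⟩
  have hsup : (⨆ n, F' n) = ⊤ := by
    refine top_le_iff.1 ?_
    rintro ⟨⟨n⟩⟩ x _
    obtain ⟨k, hk⟩ := hF n x
    exact (le_iSup F' k) _ hk
  have h : IsColimit (Cocone.mk K.V
      { app := fun n => (F' n).ι, naturality := fun _ _ _ => rfl } :
        Cocone (F'.monotone.functor ⋙ SSet.Subcomplex.toSSetFunctor)) :=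
    IsColimit.ofIsoColimit (isColimitOfPreserves (SSet.Subcomplex.toSSetFunctor)
      ((CompleteLattice.colimitCocone (F'.monotone.functor)).isColimit))
        (Cocone.ext (SSet.Subcomplex.eqToIso hsup ≪≫ SSet.Subcomplex.topIso K.V))
  refine isColimitOfReflects (Action.forget TopCat.{u} M) ?_
  exact isColimitOfPreserves SSet.toTop h

/-- The realization of the union of an increasing sequence of stable subcomplexes is a colimit. -/
noncomputable def isColimitRealSubOfIsLUB (F : ℕ →o StableSub K) (L : StableSub K)
    (hL : ∀ k, F k ≤ L) (hF : ∀ n, ∀ x : K.V _⦋n⦌, x ∈ L.1.obj (op ⦋n⦌) →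
      ∃ k, x ∈ (F k).1.obj (op ⦋n⦌)) :
    IsColimit (Cocone.mk ((realSub K).obj L)
      { app := fun k => (realSub K).map (homOfLE (hL k))
        naturality := fun _ _ _ => by
          refine ((realSub K).map_comp _ _).symm.trans ?_
          exact (Category.comp_id _).symm } : Cocone (F.monotone.functor ⋙ realSub K)) := by
  let F' : ℕ →o K.V.Subcomplex := ⟨fun n => (F n).1, fun _ _ h => F.monotone h⟩
  have hsup : (⨆ n, F' n) = L.1 := by
    refine le_antisymm (iSup_le fun k => hL k) ?_
    rintro ⟨⟨n⟩⟩ x hx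
    obtain ⟨k, hk⟩ := hF n x hx
    exact (le_iSup F' k) _ hk
  have h : IsColimit (Cocone.mk (L.1 : SSet.{u})
      { app := fun n => SSet.Subcomplex.homOfLE (hL n), naturality := fun _ _ _ => rfl } :
        Cocone (F'.monotone.functor ⋙ SSet.Subcomplex.toSSetFunctor)) :=
    IsColimit.ofIsoColimit (isColimitOfPreserves (SSet.Subcomplex.toSSetFunctor)
      ((CompleteLattice.colimitCocone (F'.monotone.functor)).isColimit))
        (Cocone.ext (SSet.Subcomplex.eqToIso hsup))
  refine isColimitOfReflects (Action.forget TopCat.{u} M) ?_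
  exact isColimitOfPreserves SSet.toTop h

end StableSubcomplexes

/-! ### Attaching simplices to subcomplexes -/

section Attach

/-- Attaching copies of `Δ[n]` along a subcomplex `A` to a subcomplex `L`, when the simplices in
question have pairwise distinct nondegenerate faces outside `A`, none of which lies in `L`. -/
lemma isPushout_attach_sset {K : SSet.{u}} {L L' : K.Subcomplex} (hLL' : L ≤ L') {n : ℕ}
    (A : (Δ[n] : SSet.{u}).Subcomplex) {P : Type u} (x : P → K _⦋n⦌)
    (τ : P → ((A : SSet.{u}) ⟶ (L : SSet.{u})))
    (hτ : ∀ p, τ p ≫ L.ι = A.ι ≫ SSet.yonedaEquiv.symm (x p))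
    (χ : P → ((Δ[n] : SSet.{u}) ⟶ (L' : SSet.{u})))
    (hχ : ∀ p, χ p ≫ L'.ι = SSet.yonedaEquiv.symm (x p))
    (hL' : L' ≤ L ⊔ ⨆ p, SSet.Subcomplex.ofSimplex (x p))
    (hn : ∀ (k : ℕ) (f : ⦋k⦌ ⟶ ⦋n⦌) [Mono f], SSet.stdSimplex.objEquiv.symm f ∉ A.obj (op ⦋k⦌) →
      ∀ p, K.map f.op (x p) ∈ K.nonDegenerate k ∧ K.map f.op (x p) ∉ L.obj (op ⦋k⦌))
    (hinj : ∀ (k : ℕ) (f g : ⦋k⦌ ⟶ ⦋n⦌) [Mono f] [Mono g],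
      SSet.stdSimplex.objEquiv.symm f ∉ A.obj (op ⦋k⦌) →
      SSet.stdSimplex.objEquiv.symm g ∉ A.obj (op ⦋k⦌) →
      ∀ p q, K.map f.op (x p) = K.map g.op (x q) → p = q ∧ f = g) :
    IsPushout (Sigma.desc τ : (∐ fun _ : P => (A : SSet.{u})) ⟶ (L : SSet.{u}))
      (Limits.Sigma.map fun _ => A.ι) (SSet.Subcomplex.homOfLE hLL') (Sigma.desc χ) := by
  let t : (∐ fun _ : P => (A : SSet.{u})) ⟶ (L : SSet.{u}) := Sigma.desc τ
  let l : (∐ fun _ : P => (A : SSet.{u})) ⟶ (∐ fun _ : P => (Δ[n] : SSet.{u})) :=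
    Limits.Sigma.map fun _ => A.ι
  let b : (∐ fun _ : P => (Δ[n] : SSet.{u})) ⟶ (L' : SSet.{u}) := Sigma.desc χ
  let ιA (p : P) : (A : SSet.{u}) ⟶ (∐ fun _ : P => (A : SSet.{u})) := Sigma.ι (fun _ => _) p
  let ιΔ (p : P) : (Δ[n] : SSet.{u}) ⟶ (∐ fun _ : P => (Δ[n] : SSet.{u})) := Sigma.ι (fun _ => _) p
  have ht (p : P) : ιA p ≫ t = τ p := Sigma.ι_desc _ _
  have hl (p : P) : ιA p ≫ l = A.ι ≫ ιΔ p := Sigma.ι_map _ _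
  have hb (p : P) : ιΔ p ≫ b = χ p := Sigma.ι_desc _ _
  have hw : t ≫ SSet.Subcomplex.homOfLE hLL' = l ≫ b := by
    refine Sigma.hom_ext _ _ fun p => ?_
    change ιA p ≫ t ≫ _ = ιA p ≫ l ≫ b
    rw [← cancel_mono L'.ι]
    rw [reassoc_of% ht p, reassoc_of% hl p, Category.assoc, Category.assoc, Category.assoc,
      reassoc_of% hb p, hχ]
    exact hτ p
  have hsurj {k : ℕ} (y : (∐ fun _ : P => (Δ[n] : SSet.{u})) _⦋k⦌) :
      ∃ (p : P) (f : ⦋k⦌ ⟶ ⦋n⦌), (ιΔ p).app _ (SSet.stdSimplex.objEquiv.symm f) = y := by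
    obtain ⟨p, z, hz⟩ := Cofan.inj_jointly_surjective_of_isColimit
      (isColimitCofanMkObjOfIsColimit ((CategoryTheory.evaluation _ _).obj _) _ _
        (coproductIsCoproduct fun _ : P => (Δ[n] : SSet.{u}))) y
    exact ⟨p, SSet.stdSimplex.objEquiv z, by rw [Equiv.symm_apply_apply]; exact hz⟩
  have hval {k : ℕ} (p : P) (f : ⦋k⦌ ⟶ ⦋n⦌) :
      (b.app _ ((ιΔ p).app _ (SSet.stdSimplex.objEquiv.symm f))).1 = K.map f.op (x p) := by
    have h := NatTrans.congr_app (show ιΔ p ≫ b ≫ L'.ι = _ by rw [reassoc_of% hb p, hχ]) (op ⦋k⦌)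
    refine (ConcreteCategory.congr_hom h (SSet.stdSimplex.objEquiv.symm f)).trans ?_
    exact SSet.yonedaEquiv_symm_app_objEquiv_symm (x p) f
  -- every simplex of `Δ[n]` outside `A` is a degeneracy of a face outside `A`
  have hfac {k : ℕ} (f : ⦋k⦌ ⟶ ⦋n⦌) (hf : SSet.stdSimplex.objEquiv.symm f ∉ A.obj (op ⦋k⦌)) :
      ∃ (m : ℕ) (e : ⦋k⦌ ⟶ ⦋m⦌) (i : ⦋m⦌ ⟶ ⦋n⦌), Epi e ∧ Mono i ∧ e ≫ i = f ∧
        SSet.stdSimplex.objEquiv.symm i ∉ A.obj (op ⦋m⦌) := by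
    refine ⟨(image f).len, factorThruImage f, image.ι f, inferInstance, inferInstance,
      image.fac _, fun hi => hf ?_⟩
    have h := A.map (factorThruImage f).op hi
    rwa [Set.mem_preimage, SSet.stdSimplex.map_objEquiv_symm, Quiver.Hom.unop_op, image.fac] at h
  have hmem {k : ℕ} (p : P) (f : ⦋k⦌ ⟶ ⦋n⦌) (hf : K.map f.op (x p) ∈ L.obj (op ⦋k⦌)) :
      SSet.stdSimplex.objEquiv.symm f ∈ A.obj (op ⦋k⦌) := by
    by_contra h
    obtain ⟨m, e, i, _, _, rfl, hi⟩ := hfac f h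
    obtain ⟨⟨σ⟩⟩ := isSplitEpi_of_epi e
    refine (hn m i hi p).2 ?_
    have h' := L.map σ.section_.op hf
    rwa [Set.mem_preimage, ← Functor.map_comp_apply, ← op_comp, ← Category.assoc, σ.id,
      Category.id_comp] at h'
  have hrange {k : ℕ} (p : P) (f : ⦋k⦌ ⟶ ⦋n⦌)
      (hf : SSet.stdSimplex.objEquiv.symm f ∈ A.obj (op ⦋k⦌)) :
      l.app _ ((ιA p).app _ ⟨_, hf⟩) = (ιΔ p).app _ (SSet.stdSimplex.objEquiv.symm f) :=
    ConcreteCategory.congr_hom (NatTrans.congr_app (hl p) (op ⦋k⦌)) ⟨_, hf⟩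
  have hmono : Mono l := inferInstanceAs (Mono (Limits.Sigma.map fun _ : P => A.ι))
  refine ⟨⟨hw⟩, ⟨evaluationJointlyReflectsColimits _ fun ⟨⟨k⟩⟩ => ?_⟩⟩
  refine (isColimitMapCoconePushoutCoconeEquiv _ _).2 (IsPushout.isColimit ?_)
  refine Types.isPushout_of_isPullback_of_mono' ?_ ?_ ?_
  · change IsPullback (t.app (op ⦋k⦌)) (l.app (op ⦋k⦌))
      ((SSet.Subcomplex.homOfLE hLL').app (op ⦋k⦌)) (b.app (op ⦋k⦌))
    rw [Types.isPullback_iff]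
    refine ⟨NatTrans.congr_app hw _, fun y₁ y₂ h => injective_of_mono (l.app (op ⦋k⦌)) h.2,
      fun z y h => ?_⟩
    obtain ⟨p, f, rfl⟩ := hsurj y
    have hz : z.1 = K.map f.op (x p) := (congrArg Subtype.val h).trans (hval p f)
    have hf := hmem p f (hz ▸ z.2)
    refine ⟨(ιA p).app _ ⟨_, hf⟩, ?_, hrange p f hf⟩
    refine Subtype.ext ?_
    rw [hz, ← hval p f, ← hrange p f hf]
    exact congrArg Subtype.val (ConcreteCategory.congr_hom (NatTrans.congr_app hw (op ⦋k⦌))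
      ((ιA p).app _ ⟨_, hf⟩))
  · change Set.range ((SSet.Subcomplex.homOfLE hLL').app (op ⦋k⦌)) ⊔
      Set.range (b.app (op ⦋k⦌)) = Set.univ
    refine Set.eq_univ_of_forall fun z => ?_
    have hz := hL' _ z.2
    rw [Subfunctor.max_obj, Subfunctor.iSup_obj, Set.mem_union, Set.mem_iUnion] at hz
    obtain hz | ⟨p, f, hf⟩ := hz
    · exact Or.inl ⟨⟨z.1, hz⟩, rfl⟩
    · refine Or.inr ⟨(ιΔ p).app _ (SSet.stdSimplex.objEquiv.symm f.unop), Subtype.ext ?_⟩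
      exact (hval p f.unop).trans hf
  · intro y₁ y₂ h₁ h₂ h
    change y₁ ∉ Set.range (l.app (op ⦋k⦌)) at h₁
    change y₂ ∉ Set.range (l.app (op ⦋k⦌)) at h₂
    change b.app (op ⦋k⦌) y₁ = b.app (op ⦋k⦌) y₂ at h
    obtain ⟨p₁, f₁, rfl⟩ := hsurj y₁
    obtain ⟨p₂, f₂, rfl⟩ := hsurj y₂
    have h' := (hval p₁ f₁).symm.trans ((congrArg Subtype.val h).trans (hval p₂ f₂))
    obtain ⟨m₁, e₁, i₁, _, _, rfl, hi₁⟩ := hfac f₁ fun hf => h₁ ⟨_, hrange p₁ f₁ hf⟩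
    obtain ⟨m₂, e₂, i₂, _, _, rfl, hi₂⟩ := hfac f₂ fun hf => h₂ ⟨_, hrange p₂ f₂ hf⟩
    rw [op_comp, op_comp, Functor.map_comp_apply, Functor.map_comp_apply] at h'
    obtain rfl := K.unique_nonDegenerate_dim _ e₁ ⟨_, (hn m₁ i₁ hi₁ p₁).1⟩ rfl
      e₂ ⟨_, (hn m₂ i₂ hi₂ p₂).1⟩ h'
    obtain ⟨rfl, rfl⟩ := hinj m₁ i₁ i₂ hi₁ hi₂ p₁ p₂ (congrArg Subtype.val
      (K.unique_nonDegenerate_simplex _ e₁ ⟨_, (hn m₁ i₁ hi₁ p₁).1⟩ rfl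
      e₂ ⟨_, (hn m₁ i₂ hi₂ p₂).1⟩ h'))
    obtain rfl := K.unique_nonDegenerate_map _ e₁ ⟨_, (hn m₁ i₁ hi₁ p₁).1⟩ rfl
      e₂ ⟨_, (hn m₁ i₁ hi₂ p₁).1⟩ h'
    rfl

variable {M : Type u} [Monoid M]

/-- The equivariant form of `isPushout_attach_sset` for realizations. -/
lemma exists_isPushout_attach {K : Action SSet.{u} M} {L L' : StableSub K} (hLL' : L ≤ L') {n : ℕ}
    (A : (Δ[n] : SSet.{u}).Subcomplex) {P : Type u} [MulAction M P] (x : P → K.V _⦋n⦌)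
    (hx : ∀ (m : M) (p : P), x (m • p) = actSimplex K m (x p))
    (hA : ∀ p, A ≤ L.1.preimage (SSet.yonedaEquiv.symm (x p)))
    (hL' : L'.1 = L.1 ⊔ ⨆ p, SSet.Subcomplex.ofSimplex (x p))
    (hn : ∀ (k : ℕ) (f : ⦋k⦌ ⟶ ⦋n⦌) [Mono f], SSet.stdSimplex.objEquiv.symm f ∉ A.obj (op ⦋k⦌) →
      ∀ p, K.V.map f.op (x p) ∈ K.V.nonDegenerate k ∧ K.V.map f.op (x p) ∉ L.1.obj (op ⦋k⦌))
    (hinj : ∀ (k : ℕ) (f g : ⦋k⦌ ⟶ ⦋n⦌) [Mono f] [Mono g],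
      SSet.stdSimplex.objEquiv.symm f ∉ A.obj (op ⦋k⦌) →
      SSet.stdSimplex.objEquiv.symm g ∉ A.obj (op ⦋k⦌) →
      ∀ p q, K.V.map f.op (x p) = K.V.map g.op (x q) → p = q ∧ f = g) :
    ∃ (s : cellSpace M P (SSet.toTop.obj (A : SSet.{u})) ⟶ (realSub K).obj L)
      (c : cellSpace M P (SSet.toTop.obj (Δ[n] : SSet.{u})) ⟶ (realSub K).obj L'),
      IsPushout s (cellSpaceMap M P (SSet.toTop.map A.ι)) ((realSub K).map (homOfLE hLL')) c := by
  let τ (p : P) : (A : SSet.{u}) ⟶ (L.1 : SSet.{u}) :=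
    SSet.Subcomplex.lift (A.ι ≫ SSet.yonedaEquiv.symm (x p)) (by
      rintro ⟨k⟩ _ ⟨y, rfl⟩
      exact hA p _ y.2)
  have hle (p : P) : SSet.Subcomplex.ofSimplex (x p) ≤ L'.1 := by
    rw [hL']
    exact (le_iSup (fun p => SSet.Subcomplex.ofSimplex (x p)) p).trans le_sup_right
  let χ (p : P) : (Δ[n] : SSet.{u}) ⟶ (L'.1 : SSet.{u}) :=
    SSet.Subcomplex.lift (SSet.yonedaEquiv.symm (x p)) (by
      rw [SSet.Subcomplex.range_eq_ofSimplex, Equiv.apply_symm_apply]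
      exact hle p)
  have hact (m : M) (p : P) : (SSet.yonedaEquiv.symm (x (m • p)) : Δ[n] ⟶ K.V) =
      SSet.yonedaEquiv.symm (x p) ≫ actHom K m := by
    rw [hx, SSet.yonedaEquiv_symm_comp]
    rfl
  have hτm (m : M) (p : P) : τ (m • p) = τ p ≫ L.actHom m := by
    rw [← cancel_mono L.1.ι]
    change A.ι ≫ SSet.yonedaEquiv.symm (x (m • p)) =
      (A.ι ≫ SSet.yonedaEquiv.symm (x p)) ≫ actHom K m
    rw [hact, Category.assoc]
  have hχm (m : M) (p : P) : χ (m • p) = χ p ≫ L'.actHom m := by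
    rw [← cancel_mono L'.1.ι]
    exact hact m p
  let s : cellSpace M P (SSet.toTop.obj (A : SSet.{u})) ⟶ (realSub K).obj L :=
    cellSpaceDesc (fun p => SSet.toTop.map (τ p)) fun m p =>
      ConcreteCategory.congr_hom ((congrArg SSet.toTop.map (hτm m p)).trans
        (SSet.toTop.map_comp _ _))
  let c : cellSpace M P (SSet.toTop.obj (Δ[n] : SSet.{u})) ⟶ (realSub K).obj L' :=
    cellSpaceDesc (fun p => SSet.toTop.map (χ p)) fun m p =>
      ConcreteCategory.congr_hom ((congrArg SSet.toTop.map (hχm m p)).trans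
        (SSet.toTop.map_comp _ _))
  have hsq : cellSpaceMap M P (SSet.toTop.map A.ι) ≫ c = s ≫ (realSub K).map (homOfLE hLL') := by
    refine mhom_ext fun y : Σ _ : P, SSet.toTop.obj (A : SSet.{u}) => ?_
    change SSet.toTop.map (χ y.1) (SSet.toTop.map A.ι y.2) =
      SSet.toTop.map (SSet.Subcomplex.homOfLE hLL') (SSet.toTop.map (τ y.1) y.2)
    rw [← TopCat.comp_app, ← TopCat.comp_app, ← SSet.toTop.map_comp, ← SSet.toTop.map_comp]
    rfl
  refine ⟨s, c, IsPushout.of_map (Action.forget TopCat.{u} M) hsq.symm ?_⟩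
  have h := (isPushout_attach_sset hLL' A x τ (fun _ => rfl) χ (fun _ => rfl) hL'.le hn hinj).map
    SSet.toTop
  refine h.of_iso' (sigmaRealizationIso fun _ : P => (A : SSet.{u})) (Iso.refl _)
    (sigmaRealizationIso fun _ : P => (Δ[n] : SSet.{u})) (Iso.refl _) ?_ ?_ ?_ ?_
  · refine TopCat.ext fun ⟨p, y⟩ => ?_
    refine (congrArg (SSet.toTop.map (Sigma.desc τ))
      (sigmaRealizationIso_hom_apply (fun _ : P => (A : SSet.{u})) p y)).trans ?_
    exact ConcreteCategory.congr_hom ((SSet.toTop.map_comp _ _).symm.trans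
      (congrArg SSet.toTop.map (Sigma.ι_desc τ p))) y
  · refine TopCat.ext fun ⟨p, y⟩ => ?_
    refine (congrArg (SSet.toTop.map (Limits.Sigma.map fun _ => A.ι))
      (sigmaRealizationIso_hom_apply (fun _ : P => (A : SSet.{u})) p y)).trans ?_
    refine Eq.trans ?_ (sigmaRealizationIso_hom_apply (fun _ : P => (Δ[n] : SSet.{u})) p
      (SSet.toTop.map A.ι y)).symm
    exact ConcreteCategory.congr_hom ((SSet.toTop.map_comp _ _).symm.trans
      ((congrArg SSet.toTop.map (Sigma.ι_map (fun _ : P => A.ι) p)).trans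
        (SSet.toTop.map_comp _ _))) y
  · rfl
  · refine TopCat.ext fun ⟨p, y⟩ => ?_
    refine (congrArg (SSet.toTop.map (Sigma.desc χ))
      (sigmaRealizationIso_hom_apply (fun _ : P => (Δ[n] : SSet.{u})) p y)).trans ?_
    exact ConcreteCategory.congr_hom ((SSet.toTop.map_comp _ _).symm.trans
      (congrArg SSet.toTop.map (Sigma.ι_desc χ p))) y

/-- The only nondegenerate simplex of `Δ[n]` outside the boundary is the top-dimensional one. -/
lemma mono_notMem_boundary_cases {n : ℕ} {Q : ∀ k : ℕ, (⦋k⦌ ⟶ ⦋n⦌) → Prop} (h : Q n (𝟙 _)) (k : ℕ)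
    (f : ⦋k⦌ ⟶ ⦋n⦌) [Mono f]
    (hf : SSet.stdSimplex.objEquiv.symm f ∉ (SSet.boundary.{u} n).obj (op ⦋k⦌)) : Q k f := by
  rw [SSet.mem_boundary_iff_notMem_range, not_exists] at hf
  have hepi : Epi f := SimplexCategory.epi_iff_surjective.2 fun j => not_not.1 (hf j)
  obtain rfl := le_antisymm (SimplexCategory.len_le_of_mono f) (SimplexCategory.len_le_of_epi f)
  rwa [SimplexCategory.eq_id_of_mono f]

/-- The nondegenerate simplices of `Δ[n + 1]` outside the horn `Λ[n + 1, i]` are the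
top-dimensional one and its face opposite to the vertex `i`. -/
lemma mono_notMem_horn_cases {n : ℕ} {i : Fin (n + 2)} {Q : ∀ k : ℕ, (⦋k⦌ ⟶ ⦋n + 1⦌) → Prop}
    (h₁ : Q (n + 1) (𝟙 _)) (h₂ : Q n (SimplexCategory.δ i)) (k : ℕ)
    (f : ⦋k⦌ ⟶ ⦋n + 1⦌) [Mono f]
    (hf : SSet.stdSimplex.objEquiv.symm f ∉ (SSet.horn.{u} (n + 1) i).obj (op ⦋k⦌)) : Q k f := by
  rw [SSet.mem_horn_iff_notMem_range] at hf
  simp only [not_exists, not_not] at hf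
  change ∀ j, j ≠ i → j ∈ Set.range (f : Fin (k + 1) → Fin (n + 2)) at hf
  have hinj := SimplexCategory.mono_iff_injective.1 (inferInstance : Mono f)
  by_cases hi : i ∈ Set.range (f : Fin (k + 1) → Fin (n + 2))
  · have hepi : Epi f := SimplexCategory.epi_iff_surjective.2 fun j => by
      by_cases hj : j = i
      · exact hj ▸ hi
      · exact hf j hj
    obtain rfl := le_antisymm (SimplexCategory.len_le_of_mono f) (SimplexCategory.len_le_of_epi f)
    rwa [SimplexCategory.eq_id_of_mono f]
  · have hr : Set.range (f : Fin (k + 1) → Fin (n + 2)) =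
        Set.range (SimplexCategory.δ i : Fin (n + 1) → Fin (n + 2)) := by
      ext j
      have : (SimplexCategory.δ i : Fin (n + 1) → Fin (n + 2)) = i.succAbove := rfl
      rw [this, Fin.range_succAbove]
      exact ⟨fun hj h => hi (h ▸ hj), hf j⟩
    obtain ⟨rfl, h⟩ := mono_eq_of_range_eq f (SimplexCategory.δ i) hr
    rw [eqToHom_refl, Category.id_comp] at h
    rwa [h]

end Attach

/-! ### The height and rank of redundant cells -/

section Rank

namespace CollapsingScheme

variable {K : SSet.{u}} (S : CollapsingScheme K)

lemma wellFounded_pred (n : ℕ) : WellFounded (S.Pred (n := n)) := by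
  rw [wellFounded_iff_isEmpty_descending_chain]
  exact ⟨fun ⟨f, hf⟩ => S.no_infinite_chain n ⟨f, hf⟩⟩

/-- The redundant cells all of whose descending chains have fewer than `k` members. -/
def shortChains (n k : ℕ) : Set (S.R n) :=
  match k with
  | 0 => ∅
  | k + 1 => {τ | ∀ τ', S.Pred τ' τ → τ' ∈ shortChains n k}

lemma shortChains_mono (n : ℕ) : Monotone (S.shortChains n) := by
  refine monotone_nat_of_le_succ fun k => ?_
  induction k with
  | zero => exact Set.empty_subset _
  | succ k ih => exact fun τ hτ τ' h => ih (hτ τ' h)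

/-- A redundant cell has finitely many immediate predecessors, so that the lengths of its
descending chains are bounded. -/
lemma exists_mem_shortChains {n : ℕ} (τ : S.R n) : ∃ k, τ ∈ S.shortChains n k := by
  classical
  induction τ using (S.wellFounded_pred n).induction with
  | _ τ ih =>
    have h (j : Fin (n + 2)) : ∃ k, ∀ τ', S.Pred τ' τ →
        K.δ j (S.c n τ : K _⦋n + 1⦌) = (τ' : K _⦋n⦌) → τ' ∈ S.shortChains n k := by
      by_cases hj : ∃ τ', S.Pred τ' τ ∧ K.δ j (S.c n τ : K _⦋n + 1⦌) = (τ' : K _⦋n⦌)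
      · obtain ⟨τ', h1, h2⟩ := hj
        obtain ⟨k, hk⟩ := ih τ' h1
        exact ⟨k, fun τ'' _ h4 => Subtype.ext (h2.symm.trans h4) ▸ hk⟩
      · exact ⟨0, fun τ' h1 h2 => absurd ⟨τ', h1, h2⟩ hj⟩
    choose k hk using h
    refine ⟨Finset.univ.sup k + 1, fun τ' hτ' => ?_⟩
    obtain ⟨j, hj, hj'⟩ := id hτ'
    exact S.shortChains_mono n (Finset.le_sup (Finset.mem_univ j)) (hk j τ' hτ' hj')

open Classical in
/-- The number of members of the longest descending chain starting at a redundant cell: the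
height of the cell plus one, as a natural number. -/
noncomputable def chainLength {n : ℕ} (τ : S.R n) : ℕ := Nat.find (S.exists_mem_shortChains τ)

lemma chainLength_lt {n : ℕ} {τ' τ : S.R n} (h : S.Pred τ' τ) :
    S.chainLength τ' < S.chainLength τ := by
  classical
  have hτ : τ ∈ S.shortChains n (S.chainLength τ) := Nat.find_spec (S.exists_mem_shortChains τ)
  cases hk : S.chainLength τ with
  | zero => rw [hk] at hτ; exact absurd hτ (Set.notMem_empty τ)
  | succ k =>
    rw [hk] at hτ
    exact Nat.lt_succ_of_le (Nat.find_min' _ (hτ τ' h))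

/-- The stage at which a redundant cell is collapsed: cells are ordered by the lengths of their
descending chains and then by the index of the face along which they are collapsed. -/
noncomputable def rank {n : ℕ} (τ : S.R n) : ℕ := S.i n τ + (n + 2) * S.chainLength τ

lemma rank_lt {n : ℕ} {τ' τ : S.R n} (h : S.Pred τ' τ) : S.rank τ' < S.rank τ := by
  have h1 : S.chainLength τ' + 1 ≤ S.chainLength τ := S.chainLength_lt h
  have h2 := (S.i n τ').2
  have h3 := Nat.mul_le_mul_left (n + 2) h1
  unfold rank
  rw [mul_add] at h3
  omega

lemma rank_mod {n : ℕ} (τ : S.R n) : S.rank τ % (n + 2) = S.i n τ := by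
  rw [rank, Nat.add_mul_mod_self_left, Nat.mod_eq_of_lt (S.i n τ).2]

lemma E_subset (n : ℕ) : S.E n ⊆ K.nonDegenerate n := fun _ h =>
  S.union_eq n ▸ Or.inl (Or.inl h)

lemma R_subset (n : ℕ) : S.R n ⊆ K.nonDegenerate n := fun _ h =>
  S.union_eq n ▸ Or.inl (Or.inr h)

lemma C_subset (n : ℕ) : S.C n ⊆ K.nonDegenerate n := fun _ h =>
  S.union_eq n ▸ Or.inr h

end CollapsingScheme

variable {M : Type u} [Monoid M] {K : Action SSet.{u} M}

/-- The action of `M` on a stable set of simplices. -/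
@[reducible] def simplexAction {n : ℕ} (T : Set (K.V _⦋n⦌))
    (hT : ∀ (m : M) (x : K.V _⦋n⦌), x ∈ T → actSimplex K m x ∈ T) : MulAction M T where
  smul m x := ⟨actSimplex K m x, hT m x x.2⟩
  one_smul x := Subtype.ext (actSimplex_one K x.1)
  mul_smul m m' x := Subtype.ext (actSimplex_mul K m m' x.1)

variable {S : CollapsingScheme K.V} {B : ∀ n : ℕ, Set (K.V _⦋n⦌)}

namespace IsEquivariantScheme

variable (hS : IsEquivariantScheme K S B)

include hS

lemma isFreeBasis {n : ℕ} (T : Set (K.V _⦋n⦌)) (hT : T ⊆ K.V.nonDegenerate n)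
    (hT' : ∀ (m : M) (x : K.V _⦋n⦌), actSimplex K m x ∈ T ↔ x ∈ T) :
    letI := simplexAction T fun m x => (hT' m x).2
    IsFreeBasis M (X := T) {e | (e : K.V _⦋n⦌) ∈ B n} := by
  rintro ⟨x, hx⟩
  obtain ⟨⟨m, b⟩, ⟨hb, hmb⟩, hu⟩ := hS.B_basis n x (hT hx)
  refine ⟨(m, ⟨b, (hT' m b).1 (by rwa [hmb])⟩), ⟨hb, Subtype.ext hmb⟩, ?_⟩
  rintro ⟨m', b', hb'⟩ ⟨h1, h2⟩
  obtain ⟨rfl, rfl⟩ := Prod.mk.inj (hu (m', b') ⟨h1, congrArg Subtype.val h2⟩)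
  rfl

/-- The action of `m ∈ M` on the redundant cells. -/
def actR {n : ℕ} (m : M) (τ : S.R n) : S.R n := ⟨actSimplex K m τ, (hS.R_iff n m τ).2 τ.2⟩

lemma c_actR {n : ℕ} (m : M) (τ : S.R n) :
    (S.c n (hS.actR m τ) : K.V _⦋n + 1⦌) = actSimplex K m (S.c n τ) := hS.c_act n m τ

/-- The index of the matching is invariant: otherwise, `mτ` would be its own predecessor. -/
lemma i_actR {n : ℕ} (m : M) (τ : S.R n) : S.i n (hS.actR m τ) = S.i n τ := by
  by_contra h
  refine S.no_infinite_chain n ⟨fun _ => hS.actR m τ, fun _ => ⟨S.i n τ, Ne.symm h, ?_⟩⟩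
  rw [hS.c_actR]
  exact (map_actSimplex K _ m _).trans (congrArg (actSimplex K m) (S.face_eq n τ))

lemma pred_actR_iff {n : ℕ} (m : M) (τ' τ : S.R n) (h : S.Pred τ' τ) :
    S.Pred (hS.actR m τ') (hS.actR m τ) := by
  obtain ⟨j, hj, hj'⟩ := h
  refine ⟨j, by rwa [hS.i_actR], ?_⟩
  rw [hS.c_actR]
  exact (map_actSimplex K _ m _).trans (congrArg (actSimplex K m) hj')

lemma exists_of_pred_actR {n : ℕ} (m : M) (τ' τ : S.R n) (h : S.Pred τ' (hS.actR m τ)) :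
    ∃ τ'', S.Pred τ'' τ ∧ hS.actR m τ'' = τ' := by
  obtain ⟨j, hj, hj'⟩ := h
  rw [hS.i_actR] at hj
  rw [hS.c_actR] at hj'
  have h1 := (map_actSimplex K (SimplexCategory.δ j) m (S.c n τ)).symm.trans hj'
  have h2 : K.V.δ j (S.c n τ : K.V _⦋n + 1⦌) ∈ S.R n :=
    (hS.R_iff n m _).1 (Set.mem_of_eq_of_mem h1 τ'.2)
  exact ⟨⟨_, h2⟩, ⟨j, hj, rfl⟩, Subtype.ext h1⟩

lemma mem_shortChains_iff {n : ℕ} (m : M) (k : ℕ) (τ : S.R n) :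
    hS.actR m τ ∈ S.shortChains n k ↔ τ ∈ S.shortChains n k := by
  induction k generalizing τ with
  | zero => exact Iff.rfl
  | succ k ih =>
    constructor
    · exact fun h τ' hτ' => (ih τ').1 (h _ (hS.pred_actR_iff m τ' τ hτ'))
    · intro h τ' hτ'
      obtain ⟨τ'', h1, rfl⟩ := hS.exists_of_pred_actR m τ' τ hτ'
      exact (ih τ'').2 (h τ'' h1)

lemma rank_actR {n : ℕ} (m : M) (τ : S.R n) : S.rank (hS.actR m τ) = S.rank τ := by
  classical
  have : S.chainLength (hS.actR m τ) = S.chainLength τ := by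
    unfold CollapsingScheme.chainLength
    simp only [hS.mem_shortChains_iff]
  rw [CollapsingScheme.rank, CollapsingScheme.rank, hS.i_actR, this]

end IsEquivariantScheme

end Rank

/-! ### The filtration of `K` by a collapsing scheme -/

section Filtration

variable {M : Type u} [Monoid M] {K : Action SSet.{u} M}

/-- A simplex of dimension `n` is nondegenerate or belongs to the subcomplex generated by the
simplices of dimension less than `n`. -/
lemma mem_nonDegenerate_or_mem_skeleton {X : SSet.{u}} {n : ℕ} (x : X _⦋n⦌) :
    x ∈ X.nonDegenerate n ∨ x ∈ (X.skeleton n).obj (op ⦋n⦌) := by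
  obtain ⟨m, f, _, y, rfl⟩ := X.exists_nonDegenerate x
  obtain h | h := (SimplexCategory.len_le_of_epi f).lt_or_eq
  · exact Or.inr ((X.skeleton n).map f.op (X.mem_skeleton y.1 h))
  · change m = n at h
    subst h
    rw [SimplexCategory.eq_id_of_epi f]
    simp

lemma mem_skeleton_iff {X : SSet.{u}} {n k : ℕ} (x : X _⦋k⦌) :
    x ∈ (X.skeleton n).obj (op ⦋k⦌) ↔
      ∃ (d : ℕ) (_ : d < n) (f : ⦋k⦌ ⟶ ⦋d⦌) (y : X _⦋d⦌), X.map f.op y = x := by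
  constructor
  · intro h
    change x ∈ (⨆ (i : Fin n) (x : X.nonDegenerate i), SSet.Subcomplex.ofSimplex x.1).obj _ at h
    rw [Subfunctor.iSup_obj, Set.mem_iUnion] at h
    obtain ⟨i, h⟩ := h
    rw [Subfunctor.iSup_obj, Set.mem_iUnion] at h
    obtain ⟨y, f, rfl⟩ := h
    exact ⟨i, i.2, f.unop, y, rfl⟩
  · rintro ⟨d, hd, f, y, rfl⟩
    exact (X.skeleton n).map f.op (X.mem_skeleton y hd)

variable (K) in
/-- The subcomplex generated by the simplices of dimension less than `n`. -/
def stableSkeleton (n : ℕ) : StableSub K :=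
  ⟨K.V.skeleton n, fun m k x hx => by
    rw [mem_skeleton_iff] at hx ⊢
    obtain ⟨d, hd, f, y, rfl⟩ := hx
    exact ⟨d, hd, f, actSimplex K m y, map_actSimplex K f m y⟩⟩

/-- The subcomplex generated by a stable subcomplex and a stable set of simplices. -/
def StableSub.adjoin (L : StableSub K) {n : ℕ} (T : Set (K.V _⦋n⦌))
    (hT : ∀ (m : M) (x : K.V _⦋n⦌), x ∈ T → actSimplex K m x ∈ T) : StableSub K :=
  ⟨L.1 ⊔ ⨆ x : T, SSet.Subcomplex.ofSimplex x.1, fun m k x hx => by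
    rw [Subfunctor.max_obj, Subfunctor.iSup_obj, Set.mem_union, Set.mem_iUnion] at hx ⊢
    obtain hx | ⟨y, f, rfl⟩ := hx
    · exact Or.inl (L.2 m k x hx)
    · exact Or.inr ⟨⟨actSimplex K m y, hT m y y.2⟩, f, map_actSimplex K f.unop m y⟩⟩

section

variable (L : StableSub K) {n : ℕ} (T : Set (K.V _⦋n⦌))
  (hT : ∀ (m : M) (x : K.V _⦋n⦌), x ∈ T → actSimplex K m x ∈ T)

lemma StableSub.mem_adjoin_iff {k : ℕ} (x : K.V _⦋k⦌) :
    x ∈ (L.adjoin T hT).1.obj (op ⦋k⦌) ↔ x ∈ L.1.obj (op ⦋k⦌) ∨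
      ∃ (y : K.V _⦋n⦌) (_ : y ∈ T) (f : ⦋k⦌ ⟶ ⦋n⦌), K.V.map f.op y = x := by
  change x ∈ (L.1 ⊔ ⨆ x : T, SSet.Subcomplex.ofSimplex x.1).obj (op ⦋k⦌) ↔ _
  rw [Subfunctor.max_obj, Subfunctor.iSup_obj, Set.mem_union, Set.mem_iUnion]
  refine or_congr Iff.rfl ⟨?_, ?_⟩
  · rintro ⟨y, f, rfl⟩
    exact ⟨y, y.2, f.unop, rfl⟩
  · rintro ⟨y, hy, f, rfl⟩
    exact ⟨⟨y, hy⟩, f.op, rfl⟩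

lemma StableSub.le_adjoin : L ≤ L.adjoin T hT := show L.1 ≤ _ from le_sup_left

lemma StableSub.adjoin_le {L' : StableSub K} (hL : L ≤ L')
    (h : ∀ x ∈ T, x ∈ L'.1.obj (op ⦋n⦌)) : L.adjoin T hT ≤ L' :=
  show L.1 ⊔ ⨆ x : T, SSet.Subcomplex.ofSimplex x.1 ≤ L'.1 from
    sup_le hL (iSup_le fun x => (SSet.Subcomplex.ofSimplex_le_iff _ _).2 (h x.1 x.2))

lemma StableSub.mem_adjoin_of_mem {x : K.V _⦋n⦌} (hx : x ∈ T) :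
    x ∈ (L.adjoin T hT).1.obj (op ⦋n⦌) :=
  (L.mem_adjoin_iff T hT x).2 (Or.inr ⟨x, hx, 𝟙 _, by simp⟩)

lemma StableSub.mem_adjoin_nonDegenerate {k : ℕ} {x : K.V _⦋k⦌} (hx : x ∈ K.V.nonDegenerate k)
    (h : x ∈ (L.adjoin T hT).1.obj (op ⦋k⦌)) : x ∈ L.1.obj (op ⦋k⦌) ∨
      ∃ (y : K.V _⦋n⦌) (_ : y ∈ T) (f : ⦋k⦌ ⟶ ⦋n⦌) (_ : Mono f), K.V.map f.op y = x := by
  obtain h | ⟨y, hy, f, hf⟩ := (L.mem_adjoin_iff T hT x).1 h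
  · exact Or.inl h
  · exact Or.inr ⟨y, hy, f, K.V.mono_of_nonDegenerate ⟨x, hx⟩ f y hf, hf⟩

/-- The nondegenerate simplices of top dimension added by `adjoin` are the given ones. -/
lemma StableSub.mem_adjoin_nonDegenerate_same {x : K.V _⦋n⦌} (hx : x ∈ K.V.nonDegenerate n)
    (h : x ∈ (L.adjoin T hT).1.obj (op ⦋n⦌)) : x ∈ L.1.obj (op ⦋n⦌) ∨ x ∈ T := by
  obtain h | ⟨y, hy, f, _, rfl⟩ := L.mem_adjoin_nonDegenerate T hT hx h
  · exact Or.inl h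
  · rw [SimplexCategory.eq_id_of_mono f]
    exact Or.inr (by simpa using hy)

lemma StableSub.mem_adjoin_nonDegenerate_lt {k : ℕ} {x : K.V _⦋k⦌} (hx : x ∈ K.V.nonDegenerate k)
    (hk : n < k) (h : x ∈ (L.adjoin T hT).1.obj (op ⦋k⦌)) : x ∈ L.1.obj (op ⦋k⦌) := by
  obtain h | ⟨y, hy, f, _, rfl⟩ := L.mem_adjoin_nonDegenerate T hT hx h
  · exact h
  · exact absurd (SimplexCategory.len_le_of_mono f) (not_le.2 hk)

end

variable {S : CollapsingScheme K.V} {B : ∀ n : ℕ, Set (K.V _⦋n⦌)}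

namespace IsEquivariantScheme

variable (hS : IsEquivariantScheme K S B)

include hS

/-- The subcomplex generated by the simplices of dimension less than `n` and the collapsible
`n`-cells. -/
def lower (n : ℕ) : StableSub K :=
  (stableSkeleton K n).adjoin (S.C n) fun m x => (hS.C_iff n m x).2

/-- The subcomplex generated by the simplices of dimension less than `n`, the collapsible
`n`-cells and the essential `n`-cells. -/
def upper (n : ℕ) : StableSub K :=
  (hS.lower n).adjoin (S.E n) fun m x => (hS.E_iff n m x).2

/-- The set of collapsible cells matched with a redundant `n`-cell of rank less than `k`. -/
def collapsed (S : CollapsingScheme K.V) (n k : ℕ) : Set (K.V _⦋n + 1⦌) :=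
  {x | ∃ τ : S.R n, S.rank τ < k ∧ (S.c n τ : K.V _⦋n + 1⦌) = x}

/-- The subcomplex obtained from `upper n` by adjoining the redundant `n`-cells of rank less
than `k` and the collapsible cells matched with them. -/
def stage (n k : ℕ) : StableSub K :=
  (hS.upper n).adjoin (collapsed S n k) fun m x => by
    rintro ⟨τ, hτ, rfl⟩
    exact ⟨hS.actR m τ, by rwa [hS.rank_actR], hS.c_actR m τ⟩

lemma lower_le_upper (n : ℕ) : hS.lower n ≤ hS.upper n := StableSub.le_adjoin _ _ _

lemma mem_upper_of_notMem_R {n : ℕ} {x : K.V _⦋n⦌} (hx : x ∉ S.R n) :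
    x ∈ (hS.upper n).1.obj (op ⦋n⦌) := by
  obtain h | h := mem_nonDegenerate_or_mem_skeleton x
  · rw [← S.union_eq n] at h
    obtain (h | h) | h := h
    · exact StableSub.mem_adjoin_of_mem _ _ _ h
    · exact absurd h hx
    · exact hS.lower_le_upper n _ (StableSub.mem_adjoin_of_mem _ _ _ h)
  · exact hS.lower_le_upper n _ (StableSub.le_adjoin (stableSkeleton K n) _ _ _ h)

lemma notMem_upper_of_mem_R {n : ℕ} {x : K.V _⦋n⦌} (hx : x ∈ S.R n) :
    x ∉ (hS.upper n).1.obj (op ⦋n⦌) := by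
  have hnd := S.R_subset n hx
  intro h
  obtain h | h := StableSub.mem_adjoin_nonDegenerate_same _ _ _ hnd h
  · obtain h | h := StableSub.mem_adjoin_nonDegenerate_same _ _ _ hnd h
    · exact lt_irrefl n ((K.V.mem_skeleton_obj_iff_of_nonDegenerate ⟨x, hnd⟩ n).1 h)
    · exact Set.disjoint_left.1 (S.disjoint_RC n) hx h
  · exact Set.disjoint_left.1 (S.disjoint_ER n) h hx

lemma notMem_upper_of_lt {n k : ℕ} {x : K.V _⦋k⦌} (hx : x ∈ K.V.nonDegenerate k) (hk : n < k) :
    x ∉ (hS.upper n).1.obj (op ⦋k⦌) := fun h =>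
  lt_asymm hk ((K.V.mem_skeleton_obj_iff_of_nonDegenerate ⟨x, hx⟩ n).1
    (StableSub.mem_adjoin_nonDegenerate_lt _ _ _ hx hk
      (StableSub.mem_adjoin_nonDegenerate_lt _ _ _ hx hk h)))

/-- A collapsible cell is present at the stages after the one at which it is collapsed. -/
lemma c_mem_stage_iff {n k : ℕ} (τ : S.R n) :
    (S.c n τ : K.V _⦋n + 1⦌) ∈ (hS.stage n k).1.obj (op ⦋n + 1⦌) ↔ S.rank τ < k := by
  constructor
  · intro h
    have hnd := S.C_subset _ (S.c n τ).2
    obtain h | ⟨τ', hτ', h⟩ := StableSub.mem_adjoin_nonDegenerate_same _ _ _ hnd h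
    · exact absurd h (hS.notMem_upper_of_lt hnd (Nat.lt_succ_self n))
    · obtain rfl := (S.bijective_c n).1 (Subtype.ext h)
      exact hτ'
  · exact fun h => StableSub.mem_adjoin_of_mem _ _ _ ⟨τ, h, rfl⟩

/-- A redundant cell is present at the stages after the one at which it is collapsed: if it is a
face of an earlier `c τ'`, then it is `τ'` or a predecessor of `τ'`. -/
lemma mem_stage_iff {n k : ℕ} (τ : S.R n) :
    (τ : K.V _⦋n⦌) ∈ (hS.stage n k).1.obj (op ⦋n⦌) ↔ S.rank τ < k := by
  constructor
  · intro h
    obtain h | ⟨_, ⟨τ', hτ', rfl⟩, f, _, h⟩ :=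
      StableSub.mem_adjoin_nonDegenerate _ _ _ (S.R_subset _ τ.2) h
    · exact absurd h (hS.notMem_upper_of_mem_R τ.2)
    · obtain ⟨j, rfl⟩ := SimplexCategory.eq_δ_of_mono f
      by_cases hj : j = S.i n τ'
      · subst hj
        obtain rfl : τ' = τ := Subtype.ext ((S.face_eq n τ').symm.trans h)
        exact hτ'
      · exact (S.rank_lt ⟨j, hj, h⟩).trans hτ'
  · intro h
    rw [← S.face_eq n τ]
    exact (hS.stage n k).1.map (SimplexCategory.δ (S.i n τ)).op ((hS.c_mem_stage_iff τ).2 h)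

lemma stage_mono (n : ℕ) : Monotone (hS.stage n) := by
  intro k l hkl
  refine StableSub.adjoin_le _ _ _ (StableSub.le_adjoin _ _ _) ?_
  rintro _ ⟨τ, hτ, rfl⟩
  exact (hS.c_mem_stage_iff τ).2 (hτ.trans_le hkl)

lemma upper_eq_stage_zero (n : ℕ) : hS.upper n = hS.stage n 0 := by
  refine le_antisymm (StableSub.le_adjoin _ _ _) (StableSub.adjoin_le _ _ _ le_rfl ?_)
  rintro _ ⟨τ, hτ, rfl⟩
  exact absurd hτ (Nat.not_lt_zero _)

lemma stage_le_lower (n k : ℕ) : hS.stage n k ≤ hS.lower (n + 1) := by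
  have hsk (x : K.V _⦋n⦌) : x ∈ (hS.lower (n + 1)).1.obj (op ⦋n⦌) :=
    StableSub.le_adjoin (stableSkeleton K (n + 1)) _ _ _ (K.V.mem_skeleton x (Nat.lt_succ_self n))
  refine StableSub.adjoin_le _ _ _ (StableSub.adjoin_le _ _ _ (StableSub.adjoin_le _ _ _ ?_
    fun x _ => hsk x) fun x _ => hsk x) ?_
  · exact le_trans (show stableSkeleton K n ≤ stableSkeleton K (n + 1) from
      K.V.skeleton.monotone (Nat.le_succ n)) (StableSub.le_adjoin _ _ _)
  · rintro _ ⟨τ, -, rfl⟩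
    exact StableSub.mem_adjoin_of_mem _ _ _ (S.c n τ).2

lemma upper_le_lower (n : ℕ) : hS.upper n ≤ hS.lower (n + 1) :=
  hS.upper_eq_stage_zero n ▸ hS.stage_le_lower n 0

lemma lower_mono : Monotone hS.lower :=
  monotone_nat_of_le_succ fun n => (hS.lower_le_upper n).trans (hS.upper_le_lower n)

/-- The collapse of `lower (n + 1)` exhausts it: this uses that every collapsible cell is matched
with a redundant one. -/
lemma exists_mem_stage {n k : ℕ} (x : K.V _⦋k⦌) (hx : x ∈ (hS.lower (n + 1)).1.obj (op ⦋k⦌)) :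
    ∃ l, x ∈ (hS.stage n l).1.obj (op ⦋k⦌) := by
  have hR (y : K.V _⦋n⦌) : ∃ l, y ∈ (hS.stage n l).1.obj (op ⦋n⦌) := by
    by_cases hy : y ∈ S.R n
    · exact ⟨_, (hS.mem_stage_iff ⟨y, hy⟩).2 (Nat.lt_succ_self _)⟩
    · exact ⟨0, hS.upper_eq_stage_zero n ▸ hS.mem_upper_of_notMem_R hy⟩
  obtain h | ⟨y, hy, f, rfl⟩ := (StableSub.mem_adjoin_iff _ _ _ x).1 hx
  · obtain ⟨d, hd, f, y, rfl⟩ := (mem_skeleton_iff x).1 h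
    obtain hd | rfl := (Nat.lt_succ_iff.1 hd).lt_or_eq
    · have h' : y ∈ (hS.upper n).1.obj (op ⦋d⦌) :=
        hS.lower_le_upper n _ (StableSub.le_adjoin (stableSkeleton K n) _ _ _
          (K.V.mem_skeleton y hd))
      rw [hS.upper_eq_stage_zero n] at h'
      exact ⟨0, (hS.stage n 0).1.map f.op h'⟩
    · obtain ⟨l, hl⟩ := hR y
      exact ⟨l, (hS.stage d l).1.map f.op hl⟩
  · obtain ⟨τ, hτ⟩ := (S.bijective_c n).2 ⟨y, hy⟩
    obtain rfl : (S.c n τ : K.V _⦋n + 1⦌) = y := congrArg Subtype.val hτ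
    exact ⟨_, (hS.stage n _).1.map f.op ((hS.c_mem_stage_iff τ).2 (Nat.lt_succ_self _))⟩

/-- Passing from `lower n` to `upper n` attaches the essential `n`-cells along their boundaries. -/
lemma exists_isPushout_upper (n : ℕ) :
    letI := simplexAction (S.E n) fun m x => (hS.E_iff n m x).2
    ∃ (s : cellSpace M (S.E n) (SSet.toTop.obj (SSet.boundary.{u} n : SSet.{u})) ⟶
        (realSub K).obj (hS.lower n))
      (c : cellSpace M (S.E n) (SSet.toTop.obj (Δ[n] : SSet.{u})) ⟶
        (realSub K).obj (hS.upper n)),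
      IsPushout s (cellSpaceMap M (S.E n) (SSet.toTop.map (SSet.boundary.{u} n).ι))
        ((realSub K).map (homOfLE (hS.lower_le_upper n))) c := by
  let _ := simplexAction (S.E n) fun m x => (hS.E_iff n m x).2
  refine exists_isPushout_attach (hS.lower_le_upper n) _ (fun x : S.E n => x.1)
    (fun _ _ => rfl) ?_ rfl ?_ ?_
  · rintro x ⟨⟨k⟩⟩ s hs
    obtain ⟨f, rfl⟩ := SSet.stdSimplex.objEquiv.symm.surjective s
    change (SSet.yonedaEquiv.symm x.1).app _ (SSet.stdSimplex.objEquiv.symm f) ∈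
      (hS.lower n).1.obj (op ⦋k⦌)
    rw [SSet.yonedaEquiv_symm_app_objEquiv_symm]
    obtain ⟨j, hj⟩ := (SSet.mem_boundary_iff_notMem_range _).1 hs
    refine StableSub.le_adjoin (stableSkeleton K n) _ _ _ ?_
    cases n with
    | zero => exact absurd ⟨0, Fin.subsingleton_one.elim _ _⟩ hj
    | succ n =>
      obtain ⟨g, rfl⟩ := SimplexCategory.eq_comp_δ_of_not_surjective' f j fun l hl => hj ⟨l, hl⟩
      exact (mem_skeleton_iff _).2 ⟨n, Nat.lt_succ_self n, g, K.V.δ j x.1, by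
        rw [op_comp, Functor.map_comp_apply]; rfl⟩
  · refine fun k f _ hf => mono_notMem_boundary_cases (Q := fun k f => ∀ x : S.E n,
      K.V.map f.op x.1 ∈ K.V.nonDegenerate k ∧ K.V.map f.op x.1 ∉ (hS.lower n).1.obj (op ⦋k⦌))
      (fun x => ?_) k f hf
    rw [op_id, Functor.map_id_apply]
    refine ⟨S.E_subset n x.2, fun h => ?_⟩
    obtain h | h := StableSub.mem_adjoin_nonDegenerate_same _ _ _ (S.E_subset n x.2) h
    · exact lt_irrefl n
        ((K.V.mem_skeleton_obj_iff_of_nonDegenerate ⟨x.1, S.E_subset n x.2⟩ n).1 h)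
    · exact Set.disjoint_left.1 (S.disjoint_EC n) x.2 h
  · refine fun k f g _ hg hf _ => mono_notMem_boundary_cases
      (Q := fun k f => ∀ (g : ⦋k⦌ ⟶ ⦋n⦌) [Mono g], ∀ p q : S.E n,
        K.V.map f.op p.1 = K.V.map g.op q.1 → p = q ∧ f = g) ?_ k f hf g
    intro g _ p q h
    obtain rfl := SimplexCategory.eq_id_of_mono g
    rw [op_id, Functor.map_id_apply, Functor.map_id_apply] at h
    exact ⟨Subtype.ext h, rfl⟩

/-- Passing from one stage to the next attaches, for each redundant cell `τ` of the given rank, the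
simplex `c τ` along a horn: the only faces which are missing are `c τ` and `τ`. -/
lemma exists_isPushout_stage (n k : ℕ) :
    letI := simplexAction {x | ∃ hx : x ∈ S.R n, S.rank ⟨x, hx⟩ = k} fun m x hx =>
      ⟨(hS.R_iff n m x).2 hx.1, (hS.rank_actR m ⟨x, hx.1⟩).trans hx.2⟩
    ∃ (i : Fin (n + 2))
      (s : cellSpace M {x | ∃ hx : x ∈ S.R n, S.rank ⟨x, hx⟩ = k}
        (SSet.toTop.obj (SSet.horn.{u} (n + 1) i : SSet.{u})) ⟶ (realSub K).obj (hS.stage n k))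
      (c : cellSpace M {x | ∃ hx : x ∈ S.R n, S.rank ⟨x, hx⟩ = k}
        (SSet.toTop.obj (Δ[n + 1] : SSet.{u})) ⟶ (realSub K).obj (hS.stage n (k + 1))),
      IsPushout s (cellSpaceMap M {x | ∃ hx : x ∈ S.R n, S.rank ⟨x, hx⟩ = k}
          (SSet.toTop.map (SSet.horn.{u} (n + 1) i).ι))
        ((realSub K).map (homOfLE (hS.stage_mono n (Nat.le_succ k)))) c := by
  let T : Set (K.V _⦋n⦌) := {x | ∃ hx : x ∈ S.R n, S.rank ⟨x, hx⟩ = k}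
  let _ : MulAction M T := simplexAction T fun m x hx =>
    ⟨(hS.R_iff n m x).2 hx.1, (hS.rank_actR m ⟨x, hx.1⟩).trans hx.2⟩
  let i : Fin (n + 2) := ⟨k % (n + 2), Nat.mod_lt _ (by omega)⟩
  let r (p : T) : S.R n := ⟨p.1, p.2.1⟩
  have hr (p : T) : S.rank (r p) = k := p.2.2
  have hi (p : T) : S.i n (r p) = i := Fin.ext ((S.rank_mod (r p)).symm.trans (by rw [hr]))
  let x (p : T) : K.V _⦋n + 1⦌ := S.c n (r p)
  have hface (p : T) : K.V.map (SimplexCategory.δ i).op (x p) = p.1 := by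
    rw [← hi p]
    exact S.face_eq n (r p)
  -- the rank determines the index of the face, so that all simplices are attached along one horn
  refine ⟨i, exists_isPushout_attach (hS.stage_mono n (Nat.le_succ k)) _ x
    (fun m p => hS.c_actR m (r p)) ?_ ?_ ?_ ?_⟩
  · rintro p ⟨⟨l⟩⟩ s hs
    obtain ⟨f, rfl⟩ := SSet.stdSimplex.objEquiv.symm.surjective s
    change (SSet.yonedaEquiv.symm (x p)).app _ (SSet.stdSimplex.objEquiv.symm f) ∈
      (hS.stage n k).1.obj (op ⦋l⦌)
    rw [SSet.yonedaEquiv_symm_app_objEquiv_symm]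
    obtain ⟨j, hj, hj'⟩ := (SSet.mem_horn_iff_notMem_range _ _).1 hs
    obtain ⟨g, rfl⟩ := SimplexCategory.eq_comp_δ_of_not_surjective' f j fun l hl => hj' ⟨l, hl⟩
    rw [op_comp, Functor.map_comp_apply]
    refine (hS.stage n k).1.map g.op ?_
    change K.V.δ j (x p) ∈ (hS.stage n k).1.obj (op ⦋n⦌)
    -- a redundant face other than `τ` is a predecessor of `τ`, hence of smaller rank
    by_cases h : K.V.δ j (x p) ∈ S.R n
    · refine (hS.mem_stage_iff ⟨_, h⟩).2 ((S.rank_lt (τ := r p) ⟨j, ?_, rfl⟩).trans_eq (hr p))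
      rwa [hi]
    · exact StableSub.le_adjoin (hS.upper n) _ _ _ (hS.mem_upper_of_notMem_R h)
  · have hle (p : T) : x p ∈ (hS.stage n (k + 1)).1.obj (op ⦋n + 1⦌) :=
      (hS.c_mem_stage_iff (r p)).2 ((hr p).trans_lt (Nat.lt_succ_self k))
    refine le_antisymm (sup_le (le_sup_left.trans le_sup_left) (iSup_le ?_))
      (sup_le (hS.stage_mono n (Nat.le_succ k))
        (iSup_le fun p => (SSet.Subcomplex.ofSimplex_le_iff _ _).2 (hle p)))
    rintro ⟨_, τ, hτ, rfl⟩
    obtain h | h := (Nat.lt_succ_iff.1 hτ).lt_or_eq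
    · exact ((SSet.Subcomplex.ofSimplex_le_iff _ _).2 ((hS.c_mem_stage_iff τ).2 h)).trans
        le_sup_left
    · exact (le_iSup (fun p : T => SSet.Subcomplex.ofSimplex (x p)) ⟨τ.1, τ.2, h⟩).trans
        le_sup_right
  · refine fun l f _ hf => mono_notMem_horn_cases (Q := fun l f => ∀ p : T,
      K.V.map f.op (x p) ∈ K.V.nonDegenerate l ∧
        K.V.map f.op (x p) ∉ (hS.stage n k).1.obj (op ⦋l⦌)) (fun p => ?_) (fun p => ?_) l f hf
    · rw [op_id, Functor.map_id_apply]
      refine ⟨S.C_subset _ (S.c n (r p)).2, fun h => ?_⟩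
      exact absurd ((hS.c_mem_stage_iff (r p)).1 h) (by rw [hr]; exact lt_irrefl k)
    · rw [hface]
      refine ⟨S.R_subset _ p.2.1, fun h => ?_⟩
      exact absurd ((hS.mem_stage_iff (r p)).1 h) (by rw [hr]; exact lt_irrefl k)
  · have hx : ∀ p q, x p = x q → p = q := fun p q h =>
      Subtype.ext (congrArg (fun τ : S.R n => τ.1) ((S.bijective_c n).1 (Subtype.ext h)))
    intro l f g _ _ hf hg
    refine mono_notMem_horn_cases
      (Q := fun l f => ∀ (g : ⦋l⦌ ⟶ ⦋n + 1⦌) [Mono g],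
        SSet.stdSimplex.objEquiv.symm g ∉ (SSet.horn.{u} (n + 1) i).obj (op ⦋l⦌) →
        ∀ p q : T, K.V.map f.op (x p) = K.V.map g.op (x q) → p = q ∧ f = g) ?_ ?_ l f hf g hg
    · intro g _ _ p q h
      obtain rfl := SimplexCategory.eq_id_of_mono g
      rw [op_id, Functor.map_id_apply, Functor.map_id_apply] at h
      exact ⟨hx p q h, rfl⟩
    · intro g _ hg p q h
      obtain ⟨j, rfl⟩ := SimplexCategory.eq_δ_of_mono g
      obtain rfl : j = i := by
        by_contra hj
        refine hg ((SSet.mem_horn_iff_notMem_range _ _).2 ⟨j, hj, ?_⟩)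
        rintro ⟨a, ha⟩
        exact Fin.succAbove_ne j a ha
      rw [hface, hface] at h
      exact ⟨Subtype.ext h, rfl⟩

/-- The inclusion of `upper n` in `lower (n + 1)` is a composite of attachments of simplices along
horns, hence has the left lifting property against fibrations. -/
lemma hasLiftingProperty_upper_lower (n : ℕ) {Z Z' : Action TopCat.{u} M} {p : Z ⟶ Z'}
    (hp : IsMFibration p) :
    HasLiftingProperty ((realSub K).map (homOfLE (hS.upper_le_lower n))) p := by
  let F : ℕ →o StableSub K := ⟨hS.stage n, hS.stage_mono n⟩
  have h (L : StableSub K) (hL : L = hS.stage n 0) (h' : L ≤ hS.lower (n + 1)) :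
      HasLiftingProperty ((realSub K).map (homOfLE h')) p := by
    subst hL
    refine HasLiftingProperty.transfiniteComposition.hasLiftingProperty_ι_app_bot
      (isColimitRealSubOfIsLUB F (hS.lower (n + 1)) (hS.stage_le_lower n)
        fun k x hx => hS.exists_mem_stage x hx) fun k _ => ?_
    obtain ⟨i, s, c, hsc⟩ := hS.exists_isPushout_stage n k
    have := HurewiczFibration.hasLiftingProperty_horn (p := p.hom) hp i
    let T : Set (K.V _⦋n⦌) := {x | ∃ hx : x ∈ S.R n, S.rank ⟨x, hx⟩ = k}
    let _ : MulAction M T := simplexAction T fun m x hx =>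
      ⟨(hS.R_iff n m x).2 hx.1, (hS.rank_actR m ⟨x, hx.1⟩).trans hx.2⟩
    have := hasLiftingProperty_cellSpaceMap (hS.isFreeBasis T
      (fun x hx => S.R_subset n hx.1) fun m x =>
        ⟨fun ⟨h, h'⟩ => ⟨(hS.R_iff n m x).1 h, by rw [← hS.rank_actR m ⟨x, _⟩]; exact h'⟩,
          fun ⟨h, h'⟩ => ⟨(hS.R_iff n m x).2 h, (hS.rank_actR m ⟨x, h⟩).trans h'⟩⟩)
      (SSet.toTop.map (SSet.horn.{u} (n + 1) i).ι) p
    exact hsc.hasLiftingProperty p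
  exact h _ (hS.upper_eq_stage_zero n) _

end IsEquivariantScheme

end Filtration

/-! ### Collapsing a filtered `M`-space -/

section Ladders

universe v w

variable {C : Type w} [Category.{v} C] [HasPushouts C] {X : ℕ ⥤ C} {X' : ℕ → C}
  (a : ∀ n, X.obj n ⟶ X' n) (b : ∀ n, X' n ⟶ X.obj (n + 1))
  (ext : ∀ n (T : C), (X' n ⟶ T) → (X.obj (n + 1) ⟶ T))

/-- The stages of the collapse: `Y₀ = X₀`, and `Yₙ₊₁` is the pushout of `X'ₙ` and `Yₙ` over `Xₙ`,
equipped with an extension to `Xₙ₊₁` of the map from `X'ₙ`. -/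
noncomputable def collapseStage (n : ℕ) : Σ Y : C, (X.obj n ⟶ Y) :=
  n.rec ⟨X.obj 0, 𝟙 _⟩ fun n s => ⟨pushout s.2 (a n), ext n _ (pushout.inr s.2 (a n))⟩

/-- The sequence of the stages of the collapse. -/
noncomputable def collapse : ℕ ⥤ C :=
  Functor.ofSequence (X := fun n => (collapseStage a ext n).1)
    fun n => pushout.inl (collapseStage a ext n).2 (a n)

variable (hab : ∀ n, a n ≫ b n = X.map (homOfLE (Nat.le_succ n)))
  (hext : ∀ n (T : C) (h : X' n ⟶ T), b n ≫ ext n T h = h)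

/-- The projection to the stages of the collapse. -/
noncomputable def toCollapse : X ⟶ collapse a ext :=
  NatTrans.ofSequence (fun n => (collapseStage a ext n).2) fun n => by
    have h : (collapse a ext).map (homOfLE (Nat.le_succ n)) =
        pushout.inl (collapseStage a ext n).2 (a n) := Functor.ofSequence_map_homOfLE_succ _ n
    refine Eq.trans ?_ (congrArg ((collapseStage a ext n).2 ≫ ·) h.symm)
    refine (congrArg (· ≫ (collapseStage a ext (n + 1)).2) (hab n).symm).trans ?_
    refine (Category.assoc _ _ _).trans ?_
    exact (congrArg (a n ≫ ·) (hext n _ (pushout.inr (collapseStage a ext n).2 (a n)))).trans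
      pushout.condition.symm

lemma isPushout_toCollapse (n : ℕ) :
    IsPushout ((toCollapse a b ext hab hext).app n) (a n)
      ((collapse a ext).map (homOfLE (Nat.le_succ n)))
      (b n ≫ (toCollapse a b ext hab hext).app (n + 1)) := by
  have h := IsPushout.of_hasPushout (collapseStage a ext n).2 (a n)
  have h₁ : (collapse a ext).map (homOfLE (Nat.le_succ n)) =
      pushout.inl (collapseStage a ext n).2 (a n) := Functor.ofSequence_map_homOfLE_succ _ n
  have h₂ : b n ≫ (toCollapse a b ext hab hext).app (n + 1) =
      pushout.inr (collapseStage a ext n).2 (a n) := hext n _ _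
  rw [h₁, h₂]
  exact h

end Ladders

section Lifting

variable {M : Type u} [Monoid M] {X Y : ℕ ⥤ Action TopCat.{u} M} (q : X ⟶ Y)
  {X' : ℕ → Action TopCat.{u} M} (a : ∀ n, X.obj n ⟶ X' n) (b : ∀ n, X' n ⟶ X.obj (n + 1))
  (hab : ∀ n, a n ≫ b n = X.map (homOfLE (Nat.le_succ n)))
  (hY : ∀ n, IsPushout (q.app n) (a n) (Y.map (homOfLE (Nat.le_succ n))) (b n ≫ q.app (n + 1)))
  {cX : Cocone X} {cY : Cocone Y} (qc : cX.pt ⟶ cY.pt)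
  (hqc : ∀ n, cX.ι.app n ≫ qc = q.app n ≫ cY.ι.app n)
  {Z B : Action TopCat.{u} M} {p : Z ⟶ B}
  {f : cX.pt ⟶ Z} {β : cY.pt ⟶ B} (hf : f ≫ p = qc ≫ β)

/-- A lift up to a fibrewise homotopy over a stage of the collapse. -/
structure PartialLift (n : ℕ) where
  /-- the lift -/
  g : Y.obj n ⟶ Z
  /-- the homotopy -/
  H : X.obj n ⟶ pathObj p
  comp_p : g ≫ p = cY.ι.app n ≫ β
  start : H ≫ pathStart p = q.app n ≫ g
  finish : H ≫ pathEnd p = cX.ι.app n ≫ f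

include hab hY hqc hf in
/-- Extension of a lift to the next stage: the homotopy is extended to `X'ₙ`, relative to its
end, which determines the lift on the pushout `Yₙ₊₁`; then the homotopy is extended to `Xₙ₊₁`,
relative to both ends. -/
lemma PartialLift.exists_succ (n : ℕ) [HasLiftingProperty (a n) (pathEnd p)]
    [HasLiftingProperty (b n) (endpoints p)] (s : PartialLift q (f := f) (β := β) (p := p) n) :
    ∃ s' : PartialLift q (f := f) (β := β) (p := p) (n + 1),
      Y.map (homOfLE (Nat.le_succ n)) ≫ s'.g = s.g ∧
      X.map (homOfLE (Nat.le_succ n)) ≫ s'.H = s.H := by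
  have wX : a n ≫ b n ≫ cX.ι.app (n + 1) = cX.ι.app n := by
    rw [← Category.assoc, hab, cX.w]
  have sq₁ : CommSq s.H (a n) (pathEnd p) (b n ≫ cX.ι.app (n + 1) ≫ f) := ⟨by
    rw [s.finish, ← wX, Category.assoc, Category.assoc]⟩
  let H' : X' n ⟶ pathObj p := sq₁.lift
  have hH' : a n ≫ H' = s.H := sq₁.fac_left
  have hH'' : H' ≫ pathEnd p = b n ≫ cX.ι.app (n + 1) ≫ f := sq₁.fac_right
  let g : Y.obj (n + 1) ⟶ Z := (hY n).desc s.g (H' ≫ pathStart p) (by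
    rw [← s.start, ← hH', Category.assoc])
  have hg : Y.map (homOfLE (Nat.le_succ n)) ≫ g = s.g := (hY n).inl_desc _ _ _
  have hg' : b n ≫ q.app (n + 1) ≫ g = H' ≫ pathStart p := by
    rw [← Category.assoc]
    exact (hY n).inr_desc _ _ _
  have hgp : g ≫ p = cY.ι.app (n + 1) ≫ β := by
    refine (hY n).hom_ext ?_ ?_
    · rw [← Category.assoc, hg, s.comp_p, ← Category.assoc, cY.w]
    · rw [Category.assoc, Category.assoc, reassoc_of% hg', pathStart_comp, reassoc_of% hH'', hf,
        reassoc_of% hqc (n + 1)]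
  have hk : (q.app (n + 1) ≫ g) ≫ p = (cX.ι.app (n + 1) ≫ f) ≫ p := by
    rw [Category.assoc, Category.assoc, hgp, hf, reassoc_of% hqc (n + 1)]
  have sq₂ : CommSq H' (b n) (endpoints p) (kerLift _ _ hk) := ⟨kerPair_ext p
    (by rw [Category.assoc, Category.assoc, kerLift_fst, hg']; rfl)
    (by rw [Category.assoc, Category.assoc, kerLift_snd, ← hH'']; rfl)⟩
  refine ⟨⟨g, sq₂.lift, hgp, ?_, ?_⟩, hg, ?_⟩
  · rw [pathStart, ← Category.assoc, sq₂.fac_right, kerLift_fst]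
  · rw [pathEnd, ← Category.assoc, sq₂.fac_right, kerLift_snd]
  · rw [← hab, Category.assoc, sq₂.fac_left, hH']

include hab hY hqc hf in
/-- The projection from `colim Xₙ` to its collapse `colim Yₙ` has the left lifting property up to
fibrewise homotopy against `p`. -/
lemma exists_lift_up_to_homotopy (hX₀ : IsInitial (X.obj 0)) (hY₀ : IsInitial (Y.obj 0))
    (hcX : IsColimit cX) (hcY : IsColimit cY)
    (ha : ∀ n, HasLiftingProperty (a n) (pathEnd p))
    (hb : ∀ n, HasLiftingProperty (b n) (endpoints p)) :
    ∃ (g : cY.pt ⟶ Z) (H : cX.pt ⟶ pathObj p), g ≫ p = β ∧ H ≫ pathStart p = qc ≫ g ∧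
      H ≫ pathEnd p = f := by
  have hstep (n : ℕ) := PartialLift.exists_succ q a b hab hY qc hqc hf n
  choose next hg hH using hstep
  let s₀ : PartialLift q (f := f) (β := β) (p := p) 0 :=
    ⟨hY₀.to _, hX₀.to _, hY₀.hom_ext _ _, hX₀.hom_ext _ _, hX₀.hom_ext _ _⟩
  let s (n : ℕ) : PartialLift q (f := f) (β := β) (p := p) n := n.rec s₀ next
  let tY : Cocone Y := Cocone.mk Z (NatTrans.ofSequence (fun n => (s n).g)
    fun n => (hg n (s n)).trans (Category.comp_id _).symm)
  let tX : Cocone X := Cocone.mk (pathObj p) (NatTrans.ofSequence (fun n => (s n).H)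
    fun n => (hH n (s n)).trans (Category.comp_id _).symm)
  have hgn (n : ℕ) : cY.ι.app n ≫ hcY.desc tY = (s n).g := hcY.fac tY n
  have hHn (n : ℕ) : cX.ι.app n ≫ hcX.desc tX = (s n).H := hcX.fac tX n
  refine ⟨hcY.desc tY, hcX.desc tX, hcY.hom_ext fun n => ?_, hcX.hom_ext fun n => ?_,
    hcX.hom_ext fun n => ?_⟩
  · rw [reassoc_of% hgn n, (s n).comp_p]
  · rw [reassoc_of% hHn n, (s n).start, reassoc_of% hqc n, hgn]
  · rw [reassoc_of% hHn n, (s n).finish]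

end Lifting

/-! ### Homotopy equivalences from lifting properties -/

section Equivalence

variable {M : Type u} [Monoid M]

variable (M) in
/-- The one-point `M`-space. -/
def pointSpace : Action TopCat.{u} M :=
  mkMSpace PUnit.{u + 1} (fun _ => ContinuousMap.id _) (fun _ => rfl) (fun _ _ _ => rfl)

/-- The map to the one-point `M`-space. -/
def toPoint (Z : Action TopCat.{u} M) : Z ⟶ pointSpace M :=
  mkMHom (Y := pointSpace M) (ContinuousMap.const _ PUnit.unit) (fun _ _ => rfl)

lemma hom_pointSpace_ext {Z : Action TopCat.{u} M} (f g : Z ⟶ pointSpace M) : f = g :=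
  mhom_ext fun _ => rfl

lemma isMFibration_toPoint (Z : Action TopCat.{u} M) : IsMFibration (toPoint Z) :=
  have : Subsingleton (pointSpace M).V := inferInstanceAs (Subsingleton PUnit)
  hurewiczFibration_of_subsingleton _

/-- The map of path objects induced by a map of `M`-spaces. -/
def pathMap {Z Z' : Action TopCat.{u} M} (φ : Z ⟶ Z') :
    pathObj (toPoint Z) ⟶ pathObj (toPoint Z') :=
  mkMHom (X := pathObj (toPoint Z)) (Y := pathObj (toPoint Z'))
    ⟨fun γ : PathSet (toPoint Z) => (⟨φ.hom.hom.comp γ.1, fun _ => rfl⟩ : PathSet (toPoint Z')),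
      ((ContinuousMap.continuous_postcomp _).comp continuous_subtype_val).subtype_mk _⟩
    (fun m γ => Subtype.ext (ContinuousMap.ext fun s =>
      hom_actPt φ m ((show PathSet (toPoint Z) from γ).1 s)))

lemma mHomotopic_of_path {X Z : Action TopCat.{u} M} (G : X ⟶ pathObj (toPoint Z)) :
    MHomotopic (G ≫ pathStart (toPoint Z)) (G ≫ pathEnd (toPoint Z)) := by
  let G' : C(X.V, PathSet (toPoint Z)) := G.hom.hom
  refine ⟨⟨⟨fun y => (G' y.2).1 y.1, ?_⟩, fun _ => rfl, fun _ => rfl⟩, fun m t x => ?_⟩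
  · exact continuous_eval.comp ((continuous_subtype_val.comp
      (G'.continuous.comp continuous_snd)).prodMk continuous_fst)
  · exact congrArg (fun γ : PathSet (toPoint Z) => γ.1 t) (hom_actPt G m x)

variable {W Y : Action TopCat.{u} M} (q : W ⟶ Y)

/-- A map with the left lifting property up to fibrewise homotopy against all fibrations is an
`M`-homotopy equivalence. -/
lemma mHomotopyEquivalent_of_lifts
    (h : ∀ {Z B : Action TopCat.{u} M} {p : Z ⟶ B}, IsMFibration p → ∀ (f : W ⟶ Z) (β : Y ⟶ B),
      f ≫ p = q ≫ β → ∃ (g : Y ⟶ Z) (H : W ⟶ pathObj p), g ≫ p = β ∧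
        H ≫ pathStart p = q ≫ g ∧ H ≫ pathEnd p = f) :
    MHomotopyEquivalent Y W := by
  obtain ⟨g, H, -, h₁, h₂⟩ := h (isMFibration_toPoint W) (𝟙 W) (toPoint Y)
    (hom_pointSpace_ext _ _)
  -- lifting `(gq, 1)` to the paths in `Y` gives the other homotopy
  obtain ⟨G, -, hG, -, -⟩ := h (isMFibration_endpoints (isMFibration_toPoint Y))
    (H ≫ pathMap q) (kerLift (g ≫ q) (𝟙 Y) (hom_pointSpace_ext _ _)) (kerPair_ext _
      (by
        change (H ≫ pathStart (toPoint W)) ≫ q = q ≫ g ≫ q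
        rw [h₁, Category.assoc])
      (by
        change (H ≫ pathEnd (toPoint W)) ≫ q = q ≫ 𝟙 Y
        rw [h₂, Category.id_comp, Category.comp_id]))
  refine ⟨g, q, ?_, ?_⟩
  · have := mHomotopic_of_path G
    rw [pathStart, pathEnd, ← Category.assoc, ← Category.assoc, hG] at this
    exact this
  · have := mHomotopic_of_path H
    rwa [h₁, h₂] at this

end Equivalence

/-! ### The collapsed complex -/

section Collapse

variable {M : Type u} [Monoid M]

/-- Homeomorphic spaces give isomorphic `M`-spaces `P × T`. -/
def cellSpaceIso (P : Type u) [MulAction M P] {T T' : TopCat.{u}} (e : T ≅ T') :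
    cellSpace M P T ≅ cellSpace M P T' where
  hom := cellSpaceMap M P e.hom
  inv := cellSpaceMap M P e.inv
  hom_inv_id := mhom_ext fun y : Σ _ : P, T =>
    Sigma.ext rfl (heq_of_eq (ConcreteCategory.congr_hom e.hom_inv_id y.2))
  inv_hom_id := mhom_ext fun y : Σ _ : P, T' =>
    Sigma.ext rfl (heq_of_eq (ConcreteCategory.congr_hom e.inv_hom_id y.2))

lemma cellSpaceMap_comp (P : Type u) [MulAction M P] {T T' T'' : TopCat.{u}} (f : T ⟶ T')
    (g : T' ⟶ T'') : cellSpaceMap M P (f ≫ g) = cellSpaceMap M P f ≫ cellSpaceMap M P g := rfl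

/-- An empty `M`-space is initial. -/
def isInitialOfIsEmpty (X : Action TopCat.{u} M) [IsEmpty X.V] : IsInitial X :=
  IsInitial.ofUniqueHom (fun Z => mkMHom ⟨fun x => isEmptyElim x, by fun_prop⟩ fun _ x =>
    isEmptyElim x) fun _ _ => mhom_ext fun x => isEmptyElim x

variable {K : Action SSet.{u} M} {S : CollapsingScheme K.V} {B : ∀ n : ℕ, Set (K.V _⦋n⦌)}

namespace IsEquivariantScheme

variable (hS : IsEquivariantScheme K S B)

include hS

lemma exists_isPushout_disk (n : ℕ) :
    letI := simplexAction (S.E n) fun m x => (hS.E_iff n m x).2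
    ∃ (s : cellSpace M (S.E n) (∂𝔻 n) ⟶ (realSub K).obj (hS.lower n))
      (c : cellSpace M (S.E n) (𝔻 n) ⟶ (realSub K).obj (hS.upper n)),
      IsPushout s (cellSpaceMap M (S.E n) (TopCat.diskBoundaryInclusion n))
        ((realSub K).map (homOfLE (hS.lower_le_upper n))) c := by
  let _ := simplexAction (S.E n) fun m x => (hS.E_iff n m x).2
  obtain ⟨s, c, h⟩ := hS.exists_isPushout_upper n
  obtain ⟨α, β, hαβ⟩ := exists_iso_diskBoundaryInclusion.{u} n
  refine ⟨cellSpaceMap M (S.E n) α.inv ≫ s, cellSpaceMap M (S.E n) β.inv ≫ c,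
    h.of_iso' (cellSpaceIso _ α.symm) (Iso.refl _) (cellSpaceIso _ β.symm) (Iso.refl _)
      (Category.comp_id _).symm ?_ ((Category.id_comp _).trans (Category.comp_id _).symm)
      (Category.comp_id _).symm⟩
  change cellSpaceMap M (S.E n) α.inv ≫ cellSpaceMap M (S.E n) _ =
    cellSpaceMap M (S.E n) _ ≫ cellSpaceMap M (S.E n) β.inv
  rw [← cellSpaceMap_comp, ← cellSpaceMap_comp]
  congr 1
  rw [Iso.inv_comp_eq, ← Category.assoc, Iso.eq_comp_inv, hαβ]

lemma isEmpty_lower_zero : IsEmpty ((realSub K).obj (hS.lower 0)).V := by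
  refine ⟨fun x => ?_⟩
  obtain ⟨k, ⟨y, hy⟩, -, -⟩ := exists_realPt ((hS.lower 0).1 : SSet.{u}) x
  obtain h | ⟨z, hz, -⟩ := (StableSub.mem_adjoin_iff _ _ _ y).1 hy
  · obtain ⟨d, hd, -⟩ := (mem_skeleton_iff y).1 h
    exact Nat.not_lt_zero d hd
  · rw [S.C_zero] at hz
    exact hz

lemma exists_mem_lower {n : ℕ} (x : K.V _⦋n⦌) : ∃ k, x ∈ (hS.lower k).1.obj (op ⦋n⦌) :=
  ⟨n + 1, StableSub.le_adjoin (stableSkeleton K (n + 1)) _ _ _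
    (K.V.mem_skeleton x (Nat.lt_succ_self n))⟩

lemma hasLiftingProperty_lower_upper (n : ℕ) {Z Z' : Action TopCat.{u} M} {p : Z ⟶ Z'}
    (hp : IsMFibration p) :
    HasLiftingProperty ((realSub K).map (homOfLE (hS.lower_le_upper n))) (pathEnd p) := by
  let _ := simplexAction (S.E n) fun m x => (hS.E_iff n m x).2
  obtain ⟨s, c, h⟩ := hS.exists_isPushout_disk n
  have := hasLiftingProperty_pathEnd hp n
  have := hasLiftingProperty_cellSpaceMap (hS.isFreeBasis (S.E n) (S.E_subset n)
    (hS.E_iff n)) (TopCat.diskBoundaryInclusion.{u} n) (pathEnd p)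
  exact h.hasLiftingProperty _

/-- Maps defined on `upper n` extend to `lower (n + 1)`. -/
lemma exists_extension (n : ℕ) (T : Action TopCat.{u} M)
    (h : (realSub K).obj (hS.upper n) ⟶ T) :
    ∃ h' : (realSub K).obj (hS.lower (n + 1)) ⟶ T,
      (realSub K).map (homOfLE (hS.upper_le_lower n)) ≫ h' = h := by
  have := hS.hasLiftingProperty_upper_lower n (isMFibration_toPoint T)
  have sq : CommSq h ((realSub K).map (homOfLE (hS.upper_le_lower n))) (toPoint T) (toPoint _) :=
    ⟨hom_pointSpace_ext _ _⟩
  exact ⟨sq.lift, sq.fac_left⟩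

/-- The `M`-CW complex obtained by collapsing the redundant and the collapsible cells. -/
lemma exists_collapse :
    ∃ (Y : Action TopCat.{u} M) (W : MCWComplex M Y), W.IsFree ∧
      MHomotopyEquivalent Y (realization K) ∧ ∃ Φ : ∀ n : ℕ, W.cell n ≃ S.E n,
        (∀ (n : ℕ) (m : M) (e : W.cell n), (Φ n (m • e) : K.V _⦋n⦌) = actSimplex K m (Φ n e)) ∧
        ∀ n : ℕ, IsFreeBasis M {e | (Φ n e : K.V _⦋n⦌) ∈ S.E n ∩ B n} := by
  let act (n : ℕ) := simplexAction (S.E n) fun m x => (hS.E_iff n m x).2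
  let X : ℕ ⥤ Action TopCat.{u} M := hS.lower_mono.functor ⋙ realSub K
  let X' (n : ℕ) : Action TopCat.{u} M := (realSub K).obj (hS.upper n)
  let a (n : ℕ) : X.obj n ⟶ X' n := (realSub K).map (homOfLE (hS.lower_le_upper n))
  let b (n : ℕ) : X' n ⟶ X.obj (n + 1) := (realSub K).map (homOfLE (hS.upper_le_lower n))
  have hab (n : ℕ) : a n ≫ b n = X.map (homOfLE (Nat.le_succ n)) :=
    ((realSub K).map_comp _ _).symm
  choose ext hext using hS.exists_extension
  let q := toCollapse a b ext hab hext
  let Y : ℕ ⥤ Action TopCat.{u} M := collapse a ext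
  have hY := isPushout_toCollapse a b ext hab hext
  let F : ℕ →o StableSub K := ⟨hS.lower, hS.lower_mono⟩
  let cX : Cocone X := Cocone.mk (realization K) (F.monotone.functor.whiskerLeft (realSubι K))
  have hcX : IsColimit cX := isColimitRealSub F fun n x => hS.exists_mem_lower x
  let qc : realization K ⟶ colimit Y :=
    hcX.desc ((Cocone.precompose q).obj (colimit.cocone Y))
  have hqc (n : ℕ) : cX.ι.app n ≫ qc = q.app n ≫ colimit.ι Y n := hcX.fac _ n
  have hempty := hS.isEmpty_lower_zero
  have hX₀ : IsInitial (X.obj 0) := @isInitialOfIsEmpty M _ _ hempty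
  choose s c hsc using hS.exists_isPushout_disk
  let W : MCWComplex M (colimit Y) :=
    { cell := fun n => S.E n
      cellAction := act
      sk := Y
      isEmpty_sk_zero := hempty
      attach := fun n => s n ≫ q.app n
      char := fun n => c n ≫ b n ≫ q.app (n + 1)
      isPushout := fun n => (hsc n).paste_horiz (hY n)
      incl := (colimit.cocone Y).ι
      isColimit := colimit.isColimit Y }
  have hbasis (n : ℕ) := hS.isFreeBasis (S.E n) (S.E_subset n) (hS.E_iff n)
  refine ⟨colimit Y, W, fun n => ⟨_, hbasis n⟩, mHomotopyEquivalent_of_lifts qc ?_,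
    fun n => Equiv.refl _, fun _ _ _ => rfl, fun n => ?_⟩
  · intro Z Z' p hp f β hf
    exact exists_lift_up_to_homotopy q a b hab hY (cY := colimit.cocone Y) qc hqc hf hX₀ hX₀ hcX
      (colimit.isColimit Y) (fun n => hS.hasLiftingProperty_lower_upper n hp)
      (fun n => hS.hasLiftingProperty_upper_lower n (isMFibration_endpoints hp))
  · convert hbasis n using 1
    ext e
    exact and_iff_right e.2

end IsEquivariantScheme

end Collapse

end MonoidCW

theorem mainTheorem2 (M : Type u) [Monoid M] :
    -- the left version
    (∀ (K : Action SSet.{u} M) (S : MonoidCW.CollapsingScheme K.V)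
      (B : ∀ n : ℕ, Set (K.V _⦋n⦌)), MonoidCW.IsEquivariantScheme K S B →
      ∃ (Y : Action TopCat.{u} M) (W : MonoidCW.MCWComplex M Y),
        W.IsFree ∧
        MonoidCW.MHomotopyEquivalent Y (MonoidCW.realization K) ∧
        ∃ Φ : ∀ n : ℕ, W.cell n ≃ S.E n,
          (∀ (n : ℕ) (m : M) (e : W.cell n),
            (Φ n (m • e) : K.V _⦋n⦌) = MonoidCW.actSimplex K m (Φ n e)) ∧
          ∀ n : ℕ, MonoidCW.IsFreeBasis M {e | (Φ n e : K.V _⦋n⦌) ∈ S.E n ∩ B n}) ∧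
    -- the two-sided version
    (∀ (K : SSet.{u}) (l : M →* End K) (r : Mᵐᵒᵖ →* End K)
      (h : ∀ (m : M) (n : Mᵐᵒᵖ), Commute (l m) (r n))
      (S : MonoidCW.CollapsingScheme K) (B : ∀ n : ℕ, Set (K _⦋n⦌)),
      MonoidCW.IsEquivariantScheme (MonoidCW.biAction K l r h) S B →
      ∃ (Y : Action TopCat.{u} (M × Mᵐᵒᵖ)) (W : MonoidCW.MCWComplex (M × Mᵐᵒᵖ) Y),
        W.IsFree ∧
        MonoidCW.MHomotopyEquivalent Y (MonoidCW.realization (MonoidCW.biAction K l r h)) ∧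
        ∃ Φ : ∀ n : ℕ, W.cell n ≃ S.E n,
          (∀ (n : ℕ) (p : M × Mᵐᵒᵖ) (e : W.cell n),
            (Φ n (p • e) : K _⦋n⦌) =
              MonoidCW.actSimplex (n := n) (MonoidCW.biAction K l r h) p (Φ n e : K _⦋n⦌)) ∧
          ∀ n : ℕ, MonoidCW.IsFreeBasis (M × Mᵐᵒᵖ)
            {e | (Φ n e : K _⦋n⦌) ∈ S.E n ∩ B n}) := by
  exact ⟨fun _ _ _ hS => hS.exists_collapse, fun _ _ _ _ _ _ hS => hS.exists_collapse⟩
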